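/- Fix a universe of sets, whose members are called small. All categories are assumed to have small morphism sets. Let $\mathcal T$ be a triangulated category with shift $S$ which has small coproducts and is well generated: there are a regular cardinal $\kappa$ and a small set $\mathcal S$ of objects of $\mathcal T$ such that (a) every object $C\in\mathcal S$ is $\kappa$-small, that is, every morphism $C\to\coprod_{i\in I}Y_i$ into a small coproduct factors through $\coprod_{i\in J}Y_i$ for some $J\subseteq I$ with $|J|<\kappa$; (b) the only thick subcategory of $\mathcal T$ that is closed under small coproducts and contains $\mathcal S$ is $\mathcal T$ itself; (c) for every small family $(X_i\to Y_i)_{i\in I}$ of morphisms of $\mathcal T$ such that $\mathcal T(C,X_i)\to\mathcal T(C,Y_i)$ is surjective for all $C\in\mathcal S$ and $i\in I$, the map $\mathcal T(C,\coprod_i X_i)\to\mathcal T(C,\coprod_i Y_i)$ is surjective for all $C\in\mathcal S$. Let $\mathcal A$ be an abelian category with small coproducts, and let $\alpha$ be a regular cardinal such that $\alpha$-filtered colimits in $\mathcal A$ are exact (every small $\alpha$-filtered colimit of exact sequences is exact). Let $H\colon\mathcal T\to\mathcal A$ be a cohomological functor (it sends exact triangles to exact sequences) which preserves small coproducts. Then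 there exists an exact localization functor $L\colon\mathcal T\to\mathcal T$, i.e. an exact functor $L$ for which there is a natural transformation $\eta\colon\mathrm{Id}_{\mathcal T}\to L$ such that $L\eta\colon L\to L^2$ is invertible and $L\eta=\eta L$, with the property that for each object $X$ of $\mathcal T$ $$LX=0\iff H(S^nX)=0\ \text{ for all } n\in\mathbb Z .$$ -/

import Mathlib

open CategoryTheory CategoryTheory.Limits CategoryTheory.Pretriangulated

universe w u u'

namespace WellGenerated

/-- `L : C ⥤ C` is a localization functor: there is `η : Id ⟶ L` such that
`Lη : L ⟶ L²` is invertible and `Lη = ηL`. -/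
def IsLocalizationFunctor {C : Type u} [Category.{w} C] (L : C ⥤ C) : Prop :=
  ∃ η : 𝟭 C ⟶ L, ∀ X : C, IsIso (L.map (η.app X)) ∧ L.map (η.app X) = η.app (L.obj X)

/-- The category `A` has `κ`-filtered colimits, and they are exact. -/
def HasExactCardinalFilteredColimits (A : Type u) [Category.{w} A]
    (κ : Cardinal.{w}) [Fact κ.IsRegular] : Prop :=
  ∀ (J : Type w) [SmallCategory J] [IsCardinalFiltered J κ],
    ∃ _ : HasColimitsOfShape J A, HasExactColimitsOfShape J A

section

variable {T : Type u} [Category.{w} T] [HasCoproducts.{w} T]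

/-- `X` is `κ`-small: every morphism from `X` to a small coproduct factors through a
subcoproduct with fewer than `κ` factors. -/
def IsCardinalSmall (κ : Cardinal.{w}) (X : T) : Prop :=
  ∀ (I : Type w) (Y : I → T) (f : X ⟶ ∐ Y),
    ∃ J : Set I, Cardinal.mk J < κ ∧
      ∃ g : X ⟶ ∐ (fun j : J => Y j), g ≫ Limits.Sigma.desc (fun j : J => Limits.Sigma.ι Y j) = f

variable [HasZeroObject T] [HasShift T ℤ] [Preadditive T]
  [∀ n : ℤ, (shiftFunctor T n).Additive] [Pretriangulated T]

/-- A localizing subcategory: a thick subcategory closed under small coproducts. -/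
structure IsLocalizing (P : ObjectProperty T) : Prop where
  triangulated : P.IsTriangulated
  retracts : P.IsStableUnderRetracts
  coproducts : ∀ I : Type w, P.IsClosedUnderColimitsOfShape (Discrete I)

/-- `T` is perfectly generated by the small set of objects `S`. -/
structure IsPerfectlyGeneratedBy (S : ObjectProperty T) : Prop where
  small : ObjectProperty.Small.{w} S
  generates : ∀ P : ObjectProperty T, IsLocalizing P → S ≤ P → ∀ X : T, P X
  perfect : ∀ (I : Type w) (X Y : I → T) (f : ∀ i, X i ⟶ Y i),
    (∀ C : T, S C → ∀ i, Function.Surjective (fun g : C ⟶ X i => g ≫ f i)) →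
    ∀ C : T, S C → Function.Surjective (fun g : C ⟶ ∐ X => g ≫ Limits.Sigma.map f)

variable (T) in
/-- `T` is well generated: for some regular cardinal `κ`, it is perfectly generated by a small set
of `κ`-small objects. -/
def IsWellGenerated : Prop :=
  ∃ κ : Cardinal.{w}, κ.IsRegular ∧
    ∃ S : ObjectProperty T, IsPerfectlyGeneratedBy S ∧ ∀ X : T, S X → IsCardinalSmall κ X

/-- `L` is exact: it commutes with the shift, by isomorphisms for which it sends exact triangles
to exact triangles. -/
def IsExactFunctor (L : T ⥤ T) : Prop :=
  ∃ _ : L.CommShift ℤ, L.IsTriangulated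

end

end WellGenerated

set_option linter.unusedSectionVars false

/-! The objects killed by every `H ∘ S^n` form a localizing subcategory `H.homologicalKernel`; let
`Q` be the Verdier quotient by it. If `Q` has a right adjoint `R`, then `R` is fully faithful, so `Q
⋙ R` is a localization functor killing exactly what `Q` kills. The morphisms inverted by `Q` are
closed under coproducts, so `Hom(Q -, Y)` turns coproducts into products
(`sendsCoproductsToProducts_Q`), and Brown representability
(`SendsCoproductsToProducts.isLeftAdjoint`) yields `R`, provided the morphism sets of the quotient
are small.

Smallness is the crux (`small_Q_hom`). Denominators of fractions are bounded once every map from a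
fixed `X` to a kernel object factors through a small set of kernel objects (`exists_factorization`).
The factoring object is the homotopy colimit of a sequence in which maps from a set of test objects
are killed step by step; it lies in the kernel as soon as the test objects jointly cover all values
of `H`.

Such a set exists (`IsWellGenerated.exists_jointly_epi`). For a large regular `lam`, let `P` be the
closure of the generators under cones and coproducts of fewer than `lam` terms. It is essentially
small and the categories `P/X` are `lam`-filtered, so exactness makes the left Kan extension `F` of
`H` restricted to `P` homological. Perfectness and smallness let maps from `P` to a coproduct factor
through coproducts of objects of `P`, so `F` respects coproducts. Then `F ⟶ H`, invertible on `P`,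
is invertible everywhere: `H X` is the colimit of `H C` over `C ⟶ X` in `P/X`. -/

namespace WellGenerated

/-! ### Sequences and the shift on their coproduct. -/

section Sequences

variable {T : Type u} [Category.{w} T] [HasCoproducts.{w} T]

/-- The coproduct of a sequence of objects. -/
noncomputable abbrev seqSigma (X : ℕ → T) : T := ∐ fun n : ULift.{w} ℕ => X n.down

/-- The inclusion of a term of a sequence into the coproduct. -/
noncomputable abbrev seqι (X : ℕ → T) (n : ℕ) : X n ⟶ seqSigma X :=
  Sigma.ι (fun n : ULift.{w} ℕ => X n.down) ⟨n⟩

lemma seqSigma_hom_ext {X : ℕ → T} {Y : T} {g h : seqSigma X ⟶ Y}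
    (H : ∀ n, seqι X n ≫ g = seqι X n ≫ h) : g = h :=
  Sigma.hom_ext _ _ fun n => H n.down

/-- The morphism out of the coproduct of a sequence with given components. -/
noncomputable def seqDesc {X : ℕ → T} {Y : T} (φ : ∀ n, X n ⟶ Y) : seqSigma X ⟶ Y :=
  Sigma.desc fun n => φ n.down

@[simp]
lemma seqι_desc {X : ℕ → T} {Y : T} (φ : ∀ n, X n ⟶ Y) (n : ℕ) :
    seqι X n ≫ seqDesc φ = φ n := by
  simp [seqDesc]

@[simp]
lemma seqι_desc_assoc {X : ℕ → T} {Y Z : T} (φ : ∀ n, X n ⟶ Y) (n : ℕ) (h : Y ⟶ Z) :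
    seqι X n ≫ seqDesc φ ≫ h = φ n ≫ h := by
  simp [← Category.assoc]

/-- The morphism between coproducts of sequences with given components. -/
noncomputable def seqMap {X Y : ℕ → T} (φ : ∀ n, X n ⟶ Y n) : seqSigma X ⟶ seqSigma Y :=
  Limits.Sigma.map fun n => φ n.down

@[simp]
lemma seqι_map {X Y : ℕ → T} (φ : ∀ n, X n ⟶ Y n) (n : ℕ) :
    seqι X n ≫ seqMap φ = φ n ≫ seqι Y n := by
  simp [seqMap]

@[simp]
lemma seqι_map_assoc {X Y : ℕ → T} {Z : T} (φ : ∀ n, X n ⟶ Y n) (n : ℕ) (h : seqSigma Y ⟶ Z) :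
    seqι X n ≫ seqMap φ ≫ h = φ n ≫ seqι Y n ≫ h := by
  simp [← Category.assoc]

/-- The endomorphism of the coproduct of a sequence induced by its transition morphisms. -/
noncomputable def seqShift (X : ℕ → T) (f : ∀ n, X n ⟶ X (n + 1)) : seqSigma X ⟶ seqSigma X :=
  seqDesc fun n => f n ≫ seqι X (n + 1)

@[simp]
lemma seqι_shift (X : ℕ → T) (f : ∀ n, X n ⟶ X (n + 1)) (n : ℕ) :
    seqι X n ≫ seqShift X f = f n ≫ seqι X (n + 1) := by
  simp [seqShift]

@[simp]
lemma seqι_shift_assoc (X : ℕ → T) (f : ∀ n, X n ⟶ X (n + 1)) (n : ℕ) {Z : T}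
    (h : seqSigma X ⟶ Z) : seqι X n ≫ seqShift X f ≫ h = f n ≫ seqι X (n + 1) ≫ h := by
  simp [← Category.assoc]

lemma seqMap_shift {X Y : ℕ → T} {f : ∀ n, X n ⟶ X (n + 1)} {g : ∀ n, Y n ⟶ Y (n + 1)}
    (φ : ∀ n, X n ⟶ Y n) (h : ∀ n, φ n ≫ g n = f n ≫ φ (n + 1)) :
    seqMap φ ≫ seqShift Y g = seqShift X f ≫ seqMap φ :=
  seqSigma_hom_ext fun n => by simp [reassoc_of% (h n)]

/-- The composition of the first `n` transition morphisms of a sequence. -/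
def seqTrans (X : ℕ → T) (f : ∀ n, X n ⟶ X (n + 1)) : ∀ n, X 0 ⟶ X n
  | 0 => 𝟙 _
  | n + 1 => seqTrans X f n ≫ f n

@[simp]
lemma seqTrans_zero (X : ℕ → T) (f : ∀ n, X n ⟶ X (n + 1)) : seqTrans X f 0 = 𝟙 _ := rfl

lemma seqTrans_succ (X : ℕ → T) (f : ∀ n, X n ⟶ X (n + 1)) (n : ℕ) :
    seqTrans X f (n + 1) = seqTrans X f n ≫ f n := rfl

lemma seqTrans_succ' (X : ℕ → T) (f : ∀ n, X n ⟶ X (n + 1)) (n : ℕ) :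
    seqTrans X f (n + 1) = f 0 ≫ seqTrans (fun n => X (n + 1)) (fun n => f (n + 1)) n := by
  induction n with
  | zero => simp [seqTrans]
  | succ n hn => rw [seqTrans_succ, hn, seqTrans_succ, Category.assoc]

/-- For a constant sequence, identity minus shift is a split monomorphism: minus the sum of the
first `n` inclusions, on the `n`-th summand, telescopes to a retraction. -/
lemma seq_comp_const_shift_eq_zero [Preadditive T] (Y : T) {C : T} (g : C ⟶ seqSigma fun _ => Y)
    (hg : g ≫ seqShift (fun _ => Y) (fun _ => 𝟙 _) = g) : g = 0 := by
  let r : seqSigma (fun _ : ℕ => Y) ⟶ seqSigma fun _ => Y :=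
    seqDesc fun n => -∑ i ∈ Finset.range n, seqι (fun _ : ℕ => Y) i
  have hr : r - seqShift (fun _ => Y) (fun _ => 𝟙 _) ≫ r = 𝟙 _ :=
    seqSigma_hom_ext fun n => by
      simp [r, Preadditive.comp_sub, Finset.sum_range_succ]
  rw [← Category.comp_id g, ← hr, Preadditive.comp_sub, reassoc_of% hg, sub_self]

end Sequences

/-! ### Cones, fibers, and their interaction with coproducts. -/

section Cones

variable {T : Type u} [Category.{w} T] [HasZeroObject T] [HasShift T ℤ] [Preadditive T]
  [∀ n : ℤ, (shiftFunctor T n).Additive] [Pretriangulated T]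

/-- A choice of third object in a distinguished triangle on a given morphism. -/
noncomputable def coneObj {X Y : T} (f : X ⟶ Y) : T := (distinguished_cocone_triangle f).choose

/-- The second morphism in the chosen distinguished triangle. -/
noncomputable def coneMap {X Y : T} (f : X ⟶ Y) : Y ⟶ coneObj f :=
  (distinguished_cocone_triangle f).choose_spec.choose

/-- The third morphism in the chosen distinguished triangle. -/
noncomputable def coneδ {X Y : T} (f : X ⟶ Y) : coneObj f ⟶ X⟦(1 : ℤ)⟧ :=
  (distinguished_cocone_triangle f).choose_spec.choose_spec.choose

lemma cone_distinguished {X Y : T} (f : X ⟶ Y) :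
    Triangle.mk f (coneMap f) (coneδ f) ∈ distTriang T :=
  (distinguished_cocone_triangle f).choose_spec.choose_spec.choose_spec

lemma comp_coneMap {X Y : T} (f : X ⟶ Y) : f ≫ coneMap f = 0 :=
  comp_distTriang_mor_zero₁₂ _ (cone_distinguished f)

lemma exists_coneMap_comp {X Y Z : T} (f : X ⟶ Y) (g : Y ⟶ Z) (h : f ≫ g = 0) :
    ∃ k : coneObj f ⟶ Z, coneMap f ≫ k = g := by
  obtain ⟨k, hk⟩ := Triangle.yoneda_exact₂ _ (cone_distinguished f) g h
  exact ⟨k, hk.symm⟩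

lemma exists_fiber {X Y : T} (f : X ⟶ Y) :
    ∃ (W : T) (w : W ⟶ X), w ≫ f = 0 ∧
      ∀ ⦃C : T⦄ (c : C ⟶ X), c ≫ f = 0 → ∃ d : C ⟶ W, d ≫ w = c := by
  obtain ⟨W, a, b, hT⟩ := distinguished_cocone_triangle₁ f
  refine ⟨W, a, comp_distTriang_mor_zero₁₂ _ hT, fun C c hc => ?_⟩
  obtain ⟨d, hd⟩ := Triangle.coyoneda_exact₂ _ hT c hc
  exact ⟨d, hd.symm⟩

end Cones

variable {T : Type u} [Category.{w} T] [HasZeroObject T] [HasShift T ℤ] [Preadditive T]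
  [∀ n : ℤ, (shiftFunctor T n).Additive] [Pretriangulated T] [HasCoproducts.{w} T]

/-- The cone map of `Sigma.map f` factors through `Sigma.map g`, so whatever the latter kills lifts;
the coproduct of the triangles need not be known to be distinguished. -/
lemma sigma_weak_kernel {I : Type w} {X Y Z : I → T} (f : ∀ i, X i ⟶ Y i) (g : ∀ i, Y i ⟶ Z i)
    (h : ∀ i, Z i ⟶ (X i)⟦(1 : ℤ)⟧) (hT : ∀ i, Triangle.mk (f i) (g i) (h i) ∈ distTriang T)
    {C : T} (c : C ⟶ ∐ Y) (hc : c ≫ Limits.Sigma.map g = 0) :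
    ∃ d : C ⟶ ∐ X, d ≫ Limits.Sigma.map f = c := by
  obtain ⟨W, p, q, hW⟩ := distinguished_cocone_triangle (Limits.Sigma.map f)
  have key (i : I) : ∃ ψ : Z i ⟶ W, g i ≫ ψ = Sigma.ι Y i ≫ p := by
    obtain ⟨ψ, hψ, -⟩ := complete_distinguished_triangle_morphism _ _ (hT i) hW
      (Sigma.ι X i) (Sigma.ι Y i) (by exact (Sigma.ι_map f i).symm)
    exact ⟨ψ, hψ⟩
  choose ψ hψ using key
  have hp : Limits.Sigma.map g ≫ Sigma.desc ψ = p := Sigma.hom_ext _ _ fun i => by simp [hψ]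
  obtain ⟨d, hd⟩ := Triangle.coyoneda_exact₂ _ hW c
    (by change c ≫ p = 0; rw [← hp, reassoc_of% hc, zero_comp])
  exact ⟨d, hd.symm⟩

/-- The coproduct of the shifts is the shift of the coproduct. -/
noncomputable def shiftSigmaIso {I : Type w} (Y : I → T) (n : ℤ) :
    (∐ fun i => (Y i)⟦n⟧) ≅ (∐ Y)⟦n⟧ :=
  (PreservesCoproduct.iso (shiftFunctor T n) Y).symm

@[simp]
lemma ι_shiftSigmaIso_hom {I : Type w} (Y : I → T) (n : ℤ) (i : I) :
    Sigma.ι (fun i => (Y i)⟦n⟧) i ≫ (shiftSigmaIso Y n).hom = (Sigma.ι Y i)⟦n⟧' := by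
  simp [shiftSigmaIso]

@[simp]
lemma ι_shiftSigmaIso_hom_assoc {I : Type w} (Y : I → T) (n : ℤ) (i : I) {Z : T}
    (h : (∐ Y)⟦n⟧ ⟶ Z) :
    Sigma.ι (fun i => (Y i)⟦n⟧) i ≫ (shiftSigmaIso Y n).hom ≫ h = (Sigma.ι Y i)⟦n⟧' ≫ h := by
  simp [← Category.assoc]

lemma shiftSigmaIso_hom_naturality {I : Type w} {Y Z : I → T} (φ : ∀ i, Y i ⟶ Z i) (n : ℤ) :
    Limits.Sigma.map (fun i => (φ i)⟦n⟧') ≫ (shiftSigmaIso Z n).hom =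
      (shiftSigmaIso Y n).hom ≫ (Limits.Sigma.map φ)⟦n⟧' :=
  Sigma.hom_ext _ _ fun i => by simp [← Functor.map_comp]

end WellGenerated

/-! ### Perfect families and homotopy colimits. -/

namespace WellGenerated

section Perfect

variable {T : Type u} [Category.{w} T]

/-- Every morphism from an object of the family `G` to the target of `f` factors through `f`. -/
def IsSurjOn {κ : Type w} (G : κ → T) {X Y : T} (f : X ⟶ Y) : Prop :=
  ∀ k (g : G k ⟶ Y), ∃ g' : G k ⟶ X, g' ≫ f = g

/-- Coproducts of morphisms which are surjective on `G` are surjective on `G`. -/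
def IsPerfect [HasCoproducts.{w} T] {κ : Type w} (G : κ → T) : Prop :=
  ∀ (I : Type w) (X Y : I → T) (f : ∀ i, X i ⟶ Y i), (∀ i, IsSurjOn G (f i)) →
    IsSurjOn G (Limits.Sigma.map f)

end Perfect

variable {T : Type u} [Category.{w} T] [HasZeroObject T] [HasShift T ℤ] [Preadditive T]
  [∀ n : ℤ, (shiftFunctor T n).Additive] [Pretriangulated T] [HasCoproducts.{w} T]

section

variable {κ : Type w} {G : κ → T} (hG : IsPerfect G)

include hG

/-- The fibers of the `h i` are surjective on `G`, hence so is their coproduct, which `Sigma.map h`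
annihilates. -/
lemma IsPerfect.comp_sigma_map_eq_zero {I : Type w} {X Y : I → T} (h : ∀ i, X i ⟶ Y i)
    (hh : ∀ i k (c : G k ⟶ X i), c ≫ h i = 0) {k : κ} (c : G k ⟶ ∐ X) :
    c ≫ Limits.Sigma.map h = 0 := by
  choose W v hv hv' using fun i => exists_fiber (h i)
  obtain ⟨c', rfl⟩ := hG I W X v (fun i k c => hv' i c (hh i k c)) k c
  have : Limits.Sigma.map v ≫ Limits.Sigma.map h = 0 := Sigma.hom_ext _ _ fun i => by
    have := hv i
    simp [reassoc_of% this]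
  rw [Category.assoc, this, comp_zero]

variable {X : ℕ → T} {f : ∀ n, X n ⟶ X (n + 1)}
  (ha : ∀ k n (c : G k ⟶ X n), ∃ c₀ : G k ⟶ X 0, (c - c₀ ≫ seqTrans X f n) ≫ f n = 0)

include ha

/-- With `W n` the fiber of `f n`, the hypothesis `ha` says that `X 0 ⊞ W n ⟶ X n` is surjective on
`G`. Perfectness passes this to the coproduct, where the shift erases the contribution of the `W n`.
-/
lemma IsPerfect.exists_seq_lift {k : κ} (g : G k ⟶ seqSigma X) :
    ∃ c : G k ⟶ seqSigma fun _ => X 0,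
      g ≫ seqShift X f = c ≫ seqMap (seqTrans X f) ≫ seqShift X f := by
  choose W v hv hv' using fun n => exists_fiber (f n)
  obtain ⟨g', hg'⟩ := hG (ULift.{w} ℕ) (fun n => X 0 ⊞ W n.down) (fun n => X n.down)
    (fun n => biprod.desc (seqTrans X f n.down) (v n.down)) (fun n k c => by
      obtain ⟨c₀, hc₀⟩ := ha k n.down c
      obtain ⟨d, hd⟩ := hv' _ _ hc₀
      exact ⟨biprod.lift c₀ d, by simp [hd]⟩) k g
  refine ⟨g' ≫ Limits.Sigma.map fun _ => biprod.fst, ?_⟩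
  rw [← hg']
  simp only [Category.assoc]
  congr 1
  refine Sigma.hom_ext _ _ fun n => ?_
  have := hv n.down
  have h₁ := seqι_shift X f n.down
  have h₂ := seqι_map_assoc (X := fun _ => X 0) (seqTrans X f) n.down (seqShift X f)
  rw [Sigma.ι_map_assoc, Sigma.ι_map_assoc]
  erw [h₁, h₂, h₁]
  ext
  · simp
  · simp [reassoc_of% this]

variable (hb : ∀ k n (c : G k ⟶ X 0), c ≫ seqTrans X f (n + 1) = 0 → c ≫ f 0 = 0)

include hb

/-- Replace `g` by a map `c` into copies of `X 0`. Its difference with its own shift dies along the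
transitions, hence by `hb` already under `f 0`. So the image of `c` in copies of `X 1` is
shift-invariant, thus zero, and `g` factors through it. -/
lemma IsPerfect.eq_zero_of_comp_seqShift_eq {k : κ} (g : G k ⟶ seqSigma X)
    (hg : g ≫ seqShift X f = g) : g = 0 := by
  obtain ⟨c, hc⟩ := hG.exists_seq_lift ha g
  have hσ : seqMap (seqTrans X f) ≫ seqShift X f =
      seqShift (fun _ => X 0) (fun _ => 𝟙 _) ≫ seqMap (seqTrans X f) :=
    seqMap_shift _ fun n => by simp [seqTrans_succ]
  have hσ₁ : seqMap (fun _ => f 0) ≫ seqShift (fun _ => X 1) (fun _ => 𝟙 _) =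
      seqShift (fun _ => X 0) (fun _ => 𝟙 _) ≫ seqMap (fun _ => f 0) :=
    seqMap_shift _ fun n => by simp
  have hfac : seqMap (seqTrans X f) ≫ seqShift X f = seqMap (fun _ => f 0) ≫
      seqDesc fun n => seqTrans (fun n => X (n + 1)) (fun n => f (n + 1)) n ≫ seqι X (n + 1) :=
    seqSigma_hom_ext fun n => by
      have := seqTrans_succ' X f n
      rw [seqTrans_succ] at this
      simp [reassoc_of% this]
  -- the maps killed by the shifted transition morphisms are killed by the first one
  have hb' (d : G k ⟶ seqSigma fun _ => X 0)
      (hd : d ≫ seqMap (seqTrans X f) ≫ seqShift X f = 0) : d ≫ seqMap (fun _ => f 0) = 0 := by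
    -- Discarding `X 0` and lowering the index turns transitions followed by the shift into a
    -- diagonal map.
    let r : seqSigma X ⟶ seqSigma fun n => X (n + 1) := seqDesc fun n =>
      match n with
      | 0 => 0
      | n + 1 => seqι (fun n => X (n + 1)) n
    have hr : seqMap (seqTrans X f) ≫ seqShift X f ≫ r =
        seqMap (X := fun _ => X 0) (Y := fun n => X (n + 1)) (fun n => seqTrans X f (n + 1)) :=
      seqSigma_hom_ext fun n => by simp [r, seqTrans_succ]
    choose V v δ hV using fun n => distinguished_cocone_triangle₁ (seqTrans X f (n + 1))
    obtain ⟨d', rfl⟩ := sigma_weak_kernel (fun n : ULift.{w} ℕ => v n.down) _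
      (fun n => δ n.down) (fun n => hV n.down) d (by
        have := hd =≫ r
        rwa [zero_comp, Category.assoc, Category.assoc, hr] at this)
    have h₀ := hG.comp_sigma_map_eq_zero (fun n : ULift.{w} ℕ => v n.down ≫ f 0)
      (fun n k c => by
        rw [← Category.assoc]
        refine hb k n.down _ ?_
        rw [Category.assoc]
        erw [comp_distTriang_mor_zero₁₂ _ (hV n.down)]
        exact comp_zero) d'
    rw [← h₀, Category.assoc]
    congr 1
    exact Sigma.hom_ext _ _ fun n => by simp [seqMap]
  have h₁ : (c - c ≫ seqShift (fun _ => X 0) (fun _ => 𝟙 _)) ≫ seqMap (fun _ => f 0) = 0 := by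
    apply hb'
    rw [Preadditive.sub_comp, sub_eq_zero, Category.assoc, ← reassoc_of% hσ, ← hc, hg,
      ← reassoc_of% hc, reassoc_of% hg, hg]
  have h₂ : c ≫ seqMap (fun _ => f 0) = 0 := by
    apply seq_comp_const_shift_eq_zero
    rw [Category.assoc, hσ₁, eq_comm, ← sub_eq_zero, ← Category.assoc, ← Preadditive.sub_comp, h₁]
  rw [← hg, hc, hfac, reassoc_of% h₂, zero_comp]

end

end WellGenerated

/-! ### Approximating an object of `D` on the generators. -/

namespace WellGenerated

variable {T : Type u} [Category.{w} T] [HasZeroObject T] [HasShift T ℤ] [Preadditive T]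
  [∀ n : ℤ, (shiftFunctor T n).Additive] [Pretriangulated T] [HasCoproducts.{w} T]

universe v₁ u₁

variable {D : Type u₁} [Category.{v₁} D] [HasZeroObject D] [HasShift D ℤ] [Preadditive D]
  [∀ n : ℤ, (shiftFunctor D n).Additive] [Pretriangulated D]

/-- For every object `Y`, the functor `X ↦ (Q.obj X ⟶ Y)` sends small coproducts to products. -/
structure SendsCoproductsToProducts (Q : T ⥤ D) : Prop where
  exists_desc {I : Type w} {X : I → T} {Y : D} (y : ∀ i, Q.obj (X i) ⟶ Y) :
    ∃ y' : Q.obj (∐ X) ⟶ Y, ∀ i, Q.map (Sigma.ι X i) ≫ y' = y i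
  eq_zero {I : Type w} {X : I → T} {Y : D} (y : Q.obj (∐ X) ⟶ Y)
    (hy : ∀ i, Q.map (Sigma.ι X i) ≫ y = 0) : y = 0

variable {Q : T ⥤ D} [Q.CommShift ℤ] [Q.IsTriangulated] [Q.Additive]
  (hQ : SendsCoproductsToProducts Q)

lemma exists_map_extension {A B C : T} {f : A ⟶ B} {g : B ⟶ C} {h : C ⟶ A⟦(1 : ℤ)⟧}
    (hT : Triangle.mk f g h ∈ distTriang T) {Y : D} (y : Q.obj B ⟶ Y) (hy : Q.map f ≫ y = 0) :
    ∃ z : Q.obj C ⟶ Y, Q.map g ≫ z = y := by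
  obtain ⟨z, hz⟩ := Triangle.yoneda_exact₂ _ (Q.map_distinguished _ hT) y hy
  exact ⟨z, hz.symm⟩

lemma exists_map_extension₃ {A B C : T} {f : A ⟶ B} {g : B ⟶ C} {h : C ⟶ A⟦(1 : ℤ)⟧}
    (hT : Triangle.mk f g h ∈ distTriang T) {Y : D} (y : Q.obj C ⟶ Y) (hy : Q.map g ≫ y = 0) :
    ∃ z : Q.obj (A⟦(1 : ℤ)⟧) ⟶ Y, Q.map h ≫ z = y :=
  exists_map_extension (rot_of_distTriang _ hT) y hy

include hQ in
lemma SendsCoproductsToProducts.hom_ext {I : Type w} {X : I → T} {Y : D} {y z : Q.obj (∐ X) ⟶ Y}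
    (h : ∀ i, Q.map (Sigma.ι X i) ≫ y = Q.map (Sigma.ι X i) ≫ z) : y = z := by
  rw [← sub_eq_zero]
  exact hQ.eq_zero _ fun i => by rw [Preadditive.comp_sub, h, sub_self]

section

variable {κ : Type w} (G : κ → T)

include hQ

lemma exists_killing_step {X : T} {Y : D} (x : Q.obj X ⟶ Y) :
    ∃ (X' : T) (f : X ⟶ X') (x' : Q.obj X' ⟶ Y), Q.map f ≫ x' = x ∧
      ∀ k (c : G k ⟶ X), Q.map c ≫ x = 0 → c ≫ f = 0 := by
  let N := Σ k, { c : G k ⟶ X // Q.map c ≫ x = 0 }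
  let v : (∐ fun n : N => G n.1) ⟶ X := Sigma.desc fun n => n.2.1
  obtain ⟨x', hx'⟩ := exists_map_extension (Q := Q) (cone_distinguished v) x
    (hQ.hom_ext fun n => by
      rw [← Functor.map_comp_assoc, comp_zero]
      simpa [v] using n.2.2)
  refine ⟨_, coneMap v, x', hx', fun k c hc => ?_⟩
  have : c = Sigma.ι (fun n : N => G n.1) ⟨k, c, hc⟩ ≫ v := by simp [v]
  rw [this, Category.assoc, comp_coneMap, comp_zero]

lemma exists_initial_step [∀ (X : T) (Y : D), Small.{w} (Q.obj X ⟶ Y)] (Y : D) :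
    ∃ (X : T) (x : Q.obj X ⟶ Y), ∀ k (y : Q.obj (G k) ⟶ Y),
      ∃ c : G k ⟶ X, Q.map c ≫ x = y := by
  let N := Σ k, Shrink.{w} (Q.obj (G k) ⟶ Y)
  obtain ⟨x, hx⟩ := hQ.exists_desc (X := fun n : N => G n.1) fun n => (equivShrink _).symm n.2
  exact ⟨_, x, fun k y => ⟨Sigma.ι (fun n : N => G n.1) ⟨k, equivShrink _ y⟩, by simp [hx]⟩⟩

/-- `X 0` hits every map from a generator, and each transition kills everything that vanishes over
`Y`. Hence whatever dies at some later stage already dies at the first one, and the homotopy colimit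
is controlled by `X 0`. -/
theorem exists_bijective_on_generators [∀ (X : T) (Y : D), Small.{w} (Q.obj X ⟶ Y)]
    (hG : IsPerfect G) (hshift : ∀ k, ∃ k', Nonempty (G k' ≅ (G k)⟦(-1 : ℤ)⟧)) (Y : D) :
    ∃ (X : T) (x : Q.obj X ⟶ Y), ∀ k,
      Function.Bijective fun c : G k ⟶ X => Q.map c ≫ x := by
  obtain ⟨X₀, x₀, h₀⟩ := exists_initial_step hQ G Y
  have step (p : Σ X : T, (Q.obj X ⟶ Y)) : ∃ (p' : Σ X : T, (Q.obj X ⟶ Y)) (f : p.1 ⟶ p'.1),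
      Q.map f ≫ p'.2 = p.2 ∧ ∀ k (c : G k ⟶ p.1), Q.map c ≫ p.2 = 0 → c ≫ f = 0 := by
    obtain ⟨X', f, x', h⟩ := exists_killing_step hQ G p.2
    exact ⟨⟨X', x'⟩, f, h⟩
  choose next tr htr hker using step
  let p : ℕ → Σ X : T, (Q.obj X ⟶ Y) := fun n => Nat.rec ⟨X₀, x₀⟩ (fun _ => next) n
  let X : ℕ → T := fun n => (p n).1
  let x : ∀ n, Q.obj (X n) ⟶ Y := fun n => (p n).2
  let f : ∀ n, X n ⟶ X (n + 1) := fun n => tr (p n)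
  have hf (n) : Q.map (f n) ≫ x (n + 1) = x n := htr (p n)
  have hk (n k) (c : G k ⟶ X n) (hc : Q.map c ≫ x n = 0) : c ≫ f n = 0 := hker (p n) k c hc
  have h₀ (k) (y : Q.obj (G k) ⟶ Y) : ∃ c : G k ⟶ X 0, Q.map c ≫ x 0 = y := h₀ k y
  have ht (n) : Q.map (seqTrans X f n) ≫ x n = x 0 := by
    induction n with
    | zero => simp
    | succ n hn => rw [seqTrans_succ, Functor.map_comp, Category.assoc, hf, hn]
  clear_value f
  clear_value x
  clear_value X
  have ha (k n) (c : G k ⟶ X n) : ∃ c₀ : G k ⟶ X 0, (c - c₀ ≫ seqTrans X f n) ≫ f n = 0 := by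
    obtain ⟨c₀, hc₀⟩ := h₀ k (Q.map c ≫ x n)
    refine ⟨c₀, hk n k _ ?_⟩
    rw [Functor.map_sub, Preadditive.sub_comp, Functor.map_comp, Category.assoc, ht, hc₀, sub_self]
  have hb (k n) (c : G k ⟶ X 0) (hc : c ≫ seqTrans X f (n + 1) = 0) : c ≫ f 0 = 0 := by
    refine hk 0 k _ ?_
    rw [← ht (n + 1), ← Functor.map_comp_assoc, hc, Functor.map_zero, zero_comp]
  have inj {k} (g : G k ⟶ seqSigma X) (hg : g ≫ (𝟙 _ - seqShift X f) = 0) : g = 0 :=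
    hG.eq_zero_of_comp_seqShift_eq ha hb g
      (by rwa [Preadditive.comp_sub, Category.comp_id, sub_eq_zero, eq_comm] at hg)
  obtain ⟨Z, q, δ, hZ⟩ := distinguished_cocone_triangle (𝟙 (seqSigma X) - seqShift X f)
  have hq : seqShift X f ≫ q = q := by
    have : (𝟙 _ - seqShift X f) ≫ q = 0 := comp_distTriang_mor_zero₁₂ _ hZ
    rwa [Preadditive.sub_comp, Category.id_comp, sub_eq_zero, eq_comm] at this
  obtain ⟨xs, hxs⟩ := hQ.exists_desc (X := fun n : ULift.{w} ℕ => X n.down) fun n => x n.down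
  have hxs (n : ℕ) : Q.map (seqι X n) ≫ xs = x n := hxs ⟨n⟩
  obtain ⟨z, hz⟩ := exists_map_extension (Q := Q) hZ xs (hQ.hom_ext fun n => by
    have h₁ := seqι_shift X f n.down
    rw [← Functor.map_comp_assoc, Preadditive.comp_sub, Category.comp_id]
    erw [h₁]
    rw [Functor.map_sub, Preadditive.sub_comp, Functor.map_comp, Category.assoc, hxs, hxs, hf,
      sub_self, comp_zero])
  have hq_n (n) : seqTrans X f n ≫ seqι X n ≫ q = seqι X 0 ≫ q := by
    induction n with
    | zero => simp
    | succ n hn =>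
      rw [← hn, seqTrans_succ, Category.assoc, ← seqι_shift_assoc, hq]
  -- every morphism from the family to `Z` comes from `X 0`
  have hsurj {k} (g : G k ⟶ Z) : ∃ c : G k ⟶ X 0, c ≫ seqι X 0 ≫ q = g := by
    -- Desuspended, `g ≫ δ` is a map from a member of the family killed by identity minus shift;
    -- this uses stability of the family under the shift by `-1`.
    have hδ : g ≫ δ = 0 := by
      obtain ⟨k', ⟨e⟩⟩ := hshift k
      let e' : (G k)⟦(-1 : ℤ)⟧⟦(1 : ℤ)⟧ ≅ G k := (shiftFunctorCompIsoId T (-1) 1 (by simp)).app _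
      obtain ⟨d, hd⟩ := (shiftFunctor T (1 : ℤ)).map_surjective (e'.hom ≫ g ≫ δ)
      have : e.hom ≫ d = 0 := inj _ ((shiftFunctor T (1 : ℤ)).map_injective (by
        have : δ ≫ (shiftFunctor T (1 : ℤ)).map (𝟙 (seqSigma X) - seqShift X f) = 0 :=
          comp_distTriang_mor_zero₃₁ _ hZ
        rw [Functor.map_comp, Functor.map_comp, hd, Category.assoc, Category.assoc, Category.assoc,
          this, comp_zero, comp_zero, comp_zero, Functor.map_zero]))
      have : d = 0 := by rw [← cancel_epi e.hom, this, comp_zero]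
      rw [← cancel_epi e'.hom, ← hd, this, Functor.map_zero, comp_zero]
    obtain ⟨g', hg'⟩ : ∃ g' : G k ⟶ seqSigma X, g = g' ≫ q :=
      Triangle.coyoneda_exact₃ _ hZ g hδ
    -- Since `q` absorbs the shift, `g' ≫ q` may be computed after shifting, where it comes from
    -- copies of `X 0`.
    obtain ⟨c, hc⟩ := hG.exists_seq_lift ha g'
    refine ⟨c ≫ seqDesc fun _ => 𝟙 _, ?_⟩
    have hc' := hc =≫ q
    simp only [Category.assoc, hq] at hc'
    rw [hg', hc', Category.assoc]
    congr 1
    exact seqSigma_hom_ext fun n => by simp [hq_n]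
  have hz₀ : Q.map (seqι X 0 ≫ q) ≫ z = x 0 := by
    rw [Functor.map_comp, Category.assoc, hz, hxs]
  refine ⟨Z, z, fun k => ⟨?_, fun y => ?_⟩⟩
  · suffices H : ∀ g : G k ⟶ Z, Q.map g ≫ z = 0 → g = 0 by
      intro g g' hgg
      rw [← sub_eq_zero]
      apply H
      rw [Functor.map_sub, Preadditive.sub_comp, sub_eq_zero]
      exact hgg
    intro g hg
    -- Vanishing over `Y` makes `c` die under `f 0`, through which `X 0 ⟶ Z` factors.
    obtain ⟨c, rfl⟩ := hsurj g
    have := hk 0 k c (by rw [← hz₀, ← Functor.map_comp_assoc, hg])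
    have h₁ := hq_n 1
    rw [seqTrans_succ, seqTrans_zero, Category.id_comp] at h₁
    rw [← h₁, reassoc_of% this, zero_comp]
  · obtain ⟨c, hc⟩ := h₀ k y
    refine ⟨c ≫ seqι X 0 ≫ q, ?_⟩
    dsimp only
    rw [Functor.map_comp, Category.assoc, hz₀, hc]

end

end WellGenerated

/-! ### Brown representability. -/

namespace WellGenerated

variable {T : Type u} [Category.{w} T] [HasZeroObject T] [HasShift T ℤ] [Preadditive T]
  [∀ n : ℤ, (shiftFunctor T n).Additive] [Pretriangulated T] [HasCoproducts.{w} T]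

/-- Quantifying over all shifts supplies the two outer hypotheses of `five`; the empty coproduct
supplies a zero object. -/
lemma isLocalizing_of_five_lemma (P : ObjectProperty T)
    (retract : ∀ ⦃X Y : T⦄, Retract X Y → P Y → P X)
    (coproduct : ∀ (I : Type w) (X : I → T), (∀ i, P (X i)) → P (∐ X))
    (five : ∀ (A B C : T) (f : A ⟶ B) (g : B ⟶ C) (h : C ⟶ A⟦(1 : ℤ)⟧),
      Triangle.mk f g h ∈ distTriang T → P A → P C → P (C⟦(-1 : ℤ)⟧) → P (A⟦(1 : ℤ)⟧) → P B) :
    IsLocalizing (fun X : T => ∀ n : ℤ, P (X⟦n⟧)) := by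
  have iso {X Y : T} (e : X ≅ Y) (hX : P X) : P Y := retract (Retract.ofIso e.symm) hX
  let R : ObjectProperty T := fun X : T => ∀ n : ℤ, P (X⟦n⟧)
  have hR : R.IsStableUnderRetracts := ⟨fun r hY n => retract (r.map (shiftFunctor T n)) (hY n)⟩
  have hR' : R.IsClosedUnderIsomorphisms := ⟨fun e hX n => iso ((shiftFunctor T n).mapIso e) (hX n)⟩
  have hcop (I : Type w) (X : I → T) (hX : ∀ i, R (X i)) : R (∐ X) := fun n =>
    iso (shiftSigmaIso X n) (coproduct _ _ fun i => hX i n)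
  have hcop' (I : Type w) : R.IsClosedUnderColimitsOfShape (Discrete I) := ⟨by
    rintro X ⟨p⟩
    have hp := hcop I (fun i => p.diag.obj ⟨i⟩) (fun i => p.prop_diag_obj ⟨i⟩)
    exact R.prop_of_iso (IsColimit.coconePointUniqueUpToIso
      (colimit.isColimit _) ((IsColimit.precomposeHomEquiv
        (Discrete.natIsoFunctor (F := p.diag)).symm _).symm p.isColimit)) hp⟩
  have zero : R.ContainsZero := ⟨∐ (PEmpty.elim : PEmpty.{w + 1} → T), by
    rw [IsZero.iff_id_eq_zero]
    exact Sigma.hom_ext _ _ fun i => i.elim, hcop _ _ fun i => i.elim⟩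
  have shift : R.IsStableUnderShift ℤ := ⟨fun a => ⟨fun X hX n =>
    iso ((shiftFunctorAdd T a n).app X) (hX _)⟩⟩
  have closed : R.IsTriangulatedClosed₂ := .mk' fun t ht h₁ h₃ n =>
    five _ _ _ _ _ _ (Triangle.shift_distinguished _ ht n) (h₁ n) (h₃ n)
      (iso ((shiftFunctorAdd T n (-1)).app _) (h₃ _)) (iso ((shiftFunctorAdd T n 1).app _) (h₁ _))
  exact { triangulated := { }, retracts := hR, coproducts := hcop' }

universe v₁ u₁

variable {D : Type u₁} [Category.{v₁} D] [HasZeroObject D] [HasShift D ℤ] [Preadditive D]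
  [∀ n : ℤ, (shiftFunctor D n).Additive] [Pretriangulated D]

variable {Q : T ⥤ D} [Q.CommShift ℤ] [Q.IsTriangulated] [Q.Additive]
  (hQ : SendsCoproductsToProducts Q)

include hQ in
-- Both `Hom(-, Z)` and `Hom(Q -, Y)` are exact on triangles and turn coproducts into products, so
-- the five lemma applies to the comparison between them.
lemma SendsCoproductsToProducts.isLocalizing_bijective {Z : T} {Y : D} (z : Q.obj Z ⟶ Y) :
    IsLocalizing (fun X : T => ∀ n : ℤ,
      Function.Bijective fun c : X⟦n⟧ ⟶ Z => Q.map c ≫ z) := by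
  have inj {X : T} (H : Function.Injective fun c : X ⟶ Z => Q.map c ≫ z) (c : X ⟶ Z)
      (hc : Q.map c ≫ z = 0) : c = 0 := H (by simp [hc])
  have inj' {X : T} (H : ∀ c : X ⟶ Z, Q.map c ≫ z = 0 → c = 0) :
      Function.Injective fun c : X ⟶ Z => Q.map c ≫ z := fun c d hcd => by
    rw [← sub_eq_zero]
    exact H _ (by rw [Functor.map_sub, Preadditive.sub_comp, sub_eq_zero]; exact hcd)
  refine isLocalizing_of_five_lemma
    (fun X : T => Function.Bijective fun c : X ⟶ Z => Q.map c ≫ z) ?_ ?_ ?_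
  · rintro X Y r ⟨hY, hY'⟩
    refine ⟨inj' fun c hc => ?_, fun y => ?_⟩
    · have := inj hY (r.r ≫ c) (by rw [Functor.map_comp, Category.assoc, hc, comp_zero])
      rw [← Category.id_comp c, ← r.retract, Category.assoc, this, comp_zero]
    · obtain ⟨c, hc⟩ := hY' (Q.map r.r ≫ y)
      refine ⟨r.i ≫ c, ?_⟩
      dsimp only at hc ⊢
      rw [Functor.map_comp, Category.assoc, hc, ← Functor.map_comp_assoc, r.retract,
        CategoryTheory.Functor.map_id, Category.id_comp]
  · refine fun I X hX => ⟨inj' fun c hc => ?_, fun y => ?_⟩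
    · refine Sigma.hom_ext _ _ fun i => ?_
      rw [comp_zero]
      exact inj (hX i).1 _ (by rw [Functor.map_comp, Category.assoc, hc, comp_zero])
    · choose c hc using fun i => (hX i).2 (Q.map (Sigma.ι X i) ≫ y)
      exact ⟨Sigma.desc c, hQ.hom_ext fun i => by simp [← hc, ← Functor.map_comp_assoc]⟩
  · refine fun A B C f g h hT hA hC hC' hA' => ⟨inj' fun c hc => ?_, fun y => ?_⟩
    · have hfg : f ≫ g = 0 := comp_distTriang_mor_zero₁₂ _ hT
      have hgh : g ≫ h = 0 := comp_distTriang_mor_zero₂₃ _ hT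
      obtain ⟨d, hd⟩ : ∃ d : C ⟶ Z, c = g ≫ d := Triangle.yoneda_exact₂ _ hT c
        (inj hA.1 _ (by
          change Q.map (f ≫ c) ≫ z = 0
          rw [Functor.map_comp, Category.assoc, hc, comp_zero]))
      obtain ⟨e, he⟩ := exists_map_extension₃ hT (Q.map d ≫ z)
        (by rw [← Functor.map_comp_assoc, ← hd, hc])
      obtain ⟨e', rfl⟩ := hA'.2 e
      have : d - h ≫ e' = 0 := inj hC.1 _ (by
        dsimp only at he
        rw [Functor.map_sub, Preadditive.sub_comp, Functor.map_comp, Category.assoc, he, sub_self])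
      rw [hd, sub_eq_zero.1 this, reassoc_of% hgh, zero_comp]
    · obtain ⟨k, hk, hk'⟩ : ∃ k : C⟦(-1 : ℤ)⟧ ⟶ A, k ≫ f = 0 ∧
          ∀ a : A ⟶ Z, k ≫ a = 0 → ∃ b : B ⟶ Z, a = f ≫ b :=
        ⟨_, comp_distTriang_mor_zero₁₂ _ (inv_rot_of_distTriang _ hT),
          Triangle.yoneda_exact₂ _ (inv_rot_of_distTriang _ hT)⟩
      obtain ⟨a, ha⟩ := hA.2 (Q.map f ≫ y)
      dsimp only at ha
      obtain ⟨b, hb⟩ := hk' a (inj hC'.1 _ (by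
        rw [Functor.map_comp, Category.assoc, ha, ← Functor.map_comp_assoc, hk, Functor.map_zero,
          zero_comp]))
      obtain ⟨x, hx⟩ := exists_map_extension (Q := Q) hT (y - Q.map b ≫ z) (by
        rw [Preadditive.comp_sub, ← Functor.map_comp_assoc, ← hb, ha, sub_self])
      obtain ⟨c, rfl⟩ := hC.2 x
      refine ⟨b + g ≫ c, ?_⟩
      dsimp only at hx ⊢
      rw [Functor.map_add, Preadditive.add_comp, Functor.map_comp Q g, Category.assoc, hx,
        add_sub_cancel]

/-- Brown representability for perfectly generated triangulated categories. -/
theorem SendsCoproductsToProducts.isLeftAdjoint [∀ (X : T) (Y : D), Small.{w} (Q.obj X ⟶ Y)]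
    (hQ : SendsCoproductsToProducts Q) {κ : Type w} {G : κ → T} (hG : IsPerfect G)
    (hshift : ∀ k (n : ℤ), ∃ k', Nonempty (G k' ≅ (G k)⟦n⟧))
    (hgen : ∀ P : ObjectProperty T, IsLocalizing P → (∀ k, P (G k)) → ∀ X, P X) :
    Q.IsLeftAdjoint := by
  rw [isLeftAdjoint_iff_hasTerminal_costructuredArrow]
  intro Y
  obtain ⟨Z, z, hz⟩ := exists_bijective_on_generators hQ G hG (fun k => hshift k (-1)) Y
  have hloc := hQ.isLocalizing_bijective z
  -- Bijectivity on the generators, which are stable under all shifts, propagates to the localizing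
  -- subcategory they generate; it then says that `z` is terminal over `Y`.
  have H (X : T) : Function.Bijective fun c : X ⟶ Z => Q.map c ≫ z := by
    have iso {A B : T} (e : A ≅ B) (hA : Function.Bijective fun c : A ⟶ Z => Q.map c ≫ z) :
        Function.Bijective fun c : B ⟶ Z => Q.map c ≫ z := by
      have h₁ : Function.Bijective fun c : B ⟶ Z => e.hom ≫ c := e.symm.homFromEquiv.bijective
      have h₂ : Function.Bijective fun y : Q.obj A ⟶ Y => Q.map e.inv ≫ y :=
        ((Q.mapIso e).homFromEquiv).bijective
      convert h₂.comp (hA.comp h₁) using 2 with c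
      change _ = Q.map e.inv ≫ Q.map (e.hom ≫ c) ≫ z
      rw [← Functor.map_comp_assoc, e.inv_hom_id_assoc]
    exact iso ((shiftFunctorZero T ℤ).app X) (hgen _ hloc (fun k n => by
      obtain ⟨k', ⟨e⟩⟩ := hshift k n
      exact iso e (hz k')) X 0)
  refine (IsTerminal.ofUniqueHom (Y := CostructuredArrow.mk z)
    (fun X => CostructuredArrow.homMk ((H X.left).2 X.hom).choose
      ((H X.left).2 X.hom).choose_spec) (fun X m => ?_)).hasTerminal
  ext
  apply (H X.left).1
  exact (CostructuredArrow.w m).trans ((H X.left).2 X.hom).choose_spec.symm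

end WellGenerated

/-! ### Essential smallness of the closure under cones and coproducts. -/

namespace WellGenerated

variable {T : Type u} [Category.{w} T] [HasZeroObject T] [HasShift T ℤ] [Preadditive T]
  [∀ n : ℤ, (shiftFunctor T n).Additive] [Pretriangulated T] [HasCoproducts.{w} T]

/-- Closure under cones and under coproducts with fewer than `lam` terms. -/
structure IsConeCoproductClosed (lam : Cardinal.{w}) (P : ObjectProperty T) : Prop where
  cone {X Y Z : T} {f : X ⟶ Y} {g : Y ⟶ Z} {h : Z ⟶ X⟦(1 : ℤ)⟧}
    (hT : Triangle.mk f g h ∈ distTriang T) (hX : P X) (hY : P Y) : P Z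
  coproduct {I : Type w} (hI : Cardinal.mk I < lam) (X : I → T) (hX : ∀ i, P (X i)) : P (∐ X)

/-- The smallest property containing `P` which is closed under cones and under coproducts with
fewer than `lam` terms. -/
def coneCoproductClosure (lam : Cardinal.{w}) (P : ObjectProperty T) : ObjectProperty T :=
  fun X => ∀ M : ObjectProperty T, P ≤ M → IsConeCoproductClosed lam M → M X

lemma isConeCoproductClosed_closure (lam : Cardinal.{w}) (P : ObjectProperty T) :
    IsConeCoproductClosed lam (coneCoproductClosure lam P) where
  cone hT hX hY M hM hM' := hM'.cone hT (hX M hM hM') (hY M hM hM')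
  coproduct hI X hX M hM hM' := hM'.coproduct hI X fun i => hX i M hM hM'

lemma le_coneCoproductClosure (lam : Cardinal.{w}) (P : ObjectProperty T) :
    P ≤ coneCoproductClosure lam P := fun _ hX _ hM _ => hM _ hX

section Small

variable (lam : Cardinal.{w}) (P : ObjectProperty T)

/-- One step in the construction of the closure under cones and small coproducts. -/
noncomputable def closureStep (Q : ObjectProperty T) : ObjectProperty T :=
  P ⊔ .ofObj (fun x : Σ X Y : Subtype Q, X.1 ⟶ Y.1 => coneObj x.2.2) ⊔
    .ofObj (fun x : Σ J : Set lam.ord.ToType, (J → Subtype Q) => ∐ fun j => (x.2 j).1)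

/-- The transfinite iteration of `closureStep`. -/
noncomputable def closureIter : lam.ord.ToType → ObjectProperty T :=
  wellFounded_lt.fix fun o ih => closureStep lam P (⨆ a : { a // a < o }, ih a.1 a.2)

lemma closureIter_eq (o : lam.ord.ToType) :
    closureIter lam P o = closureStep lam P (⨆ a : { a // a < o }, closureIter lam P a.1) :=
  WellFounded.fix_eq _ _ _

instance small_closureStep (Q : ObjectProperty T) [ObjectProperty.Small.{w} P]
    [ObjectProperty.Small.{w} Q] : ObjectProperty.Small.{w} (closureStep lam P Q) := by
  dsimp only [closureStep]
  infer_instance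

instance small_closureIter [ObjectProperty.Small.{w} P] (o : lam.ord.ToType) :
    ObjectProperty.Small.{w} (closureIter lam P o) := by
  refine wellFounded_lt.induction (C := fun o => ObjectProperty.Small.{w} (closureIter lam P o))
    o fun o ih => ?_
  have (a : { a // a < o }) := ih a.1 a.2
  rw [closureIter_eq]
  infer_instance

variable {lam}

lemma exists_gt_of_card_lt (hlam : lam.IsRegular) {I : Type w} (hI : Cardinal.mk I < lam)
    (o : I → lam.ord.ToType) : ∃ a, ∀ i, o i < a := by
  have : Fact lam.IsRegular := ⟨hlam⟩
  have := Cardinal.noMaxOrder hlam.aleph0_le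
  have hI' : HasCardinalLT I lam := by rwa [hasCardinalLT_iff_cardinal_mk_lt]
  obtain ⟨a, ha⟩ := exists_gt (IsCardinalFiltered.max o hI')
  exact ⟨a, fun i => (leOfHom (IsCardinalFiltered.toMax o hI' i)).trans_lt ha⟩

/-- By regularity, fewer than `lam` stages have a common strict upper bound, so all ingredients of a
cone or coproduct are available at one stage. -/
lemma isConeCoproductClosed_iSup_closureIter (hlam : lam.IsRegular) :
    IsConeCoproductClosed lam (⨆ o, closureIter lam P o).isoClosure where
  cone {X Y Z f g h} hT := by
    rintro ⟨X', hX', ⟨e⟩⟩ ⟨Y', hY', ⟨e'⟩⟩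
    simp only [iSup_apply, iSup_Prop_eq] at hX' hY'
    obtain ⟨a, ha⟩ := hX'
    obtain ⟨b, hb⟩ := hY'
    have := Cardinal.noMaxOrder hlam.aleph0_le
    obtain ⟨o, ho⟩ := exists_gt (max a b)
    refine ⟨coneObj (e.inv ≫ f ≫ e'.hom), ?_, ⟨?_⟩⟩
    · simp only [iSup_apply, iSup_Prop_eq]
      refine ⟨o, ?_⟩
      rw [closureIter_eq]
      refine Or.inl (Or.inr ?_)
      exact ObjectProperty.ofObj_apply
        (fun x : Σ X Y : Subtype (⨆ a : { a // a < o }, closureIter lam P a.1), X.1 ⟶ Y.1 =>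
          coneObj x.2.2) ⟨⟨X', by
            simp only [iSup_apply, iSup_Prop_eq]
            exact ⟨⟨a, (le_max_left _ _).trans_lt ho⟩, ha⟩⟩, ⟨Y', by
            simp only [iSup_apply, iSup_Prop_eq]
            exact ⟨⟨b, (le_max_right _ _).trans_lt ho⟩, hb⟩⟩, e.inv ≫ f ≫ e'.hom⟩
    · exact Triangle.π₃.mapIso (isoTriangleOfIso₁₂ _ _ hT
        (cone_distinguished (e.inv ≫ f ≫ e'.hom)) e e' (by simp [Triangle.mk]))
  coproduct {I} hI X hX := by
    choose X' hX' e using hX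
    simp only [iSup_apply, iSup_Prop_eq] at hX'
    choose a ha using hX'
    obtain ⟨o, ho⟩ := exists_gt_of_card_lt hlam hI a
    obtain ⟨φ⟩ : Nonempty (I ↪ lam.ord.ToType) := by
      rw [← Cardinal.le_def, Cardinal.mk_ord_toType]
      exact hI.le
    let ε : I ≃ Set.range φ := Equiv.ofInjective φ φ.injective
    refine ⟨∐ fun j : Set.range φ => X' (ε.symm j), ?_, ⟨?_⟩⟩
    · simp only [iSup_apply, iSup_Prop_eq]
      refine ⟨o, ?_⟩
      rw [closureIter_eq]
      refine Or.inr ?_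
      exact ObjectProperty.ofObj_apply
        (fun x : Σ J : Set lam.ord.ToType,
          (J → Subtype (⨆ a : { a // a < o }, closureIter lam P a.1)) => ∐ fun j => (x.2 j).1)
        ⟨Set.range φ, fun j => ⟨X' (ε.symm j), by
          simp only [iSup_apply, iSup_Prop_eq]
          exact ⟨⟨_, ho _⟩, ha _⟩⟩⟩
    · exact Sigma.mapIso (fun i => (e i).some) ≪≫ (Sigma.reindex ε.symm X').symm

/-- The iteration also admits coproducts with `lam` terms and may overshoot the closure; only an
upper bound is needed. -/
lemma essentiallySmall_coneCoproductClosure (hlam : lam.IsRegular)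
    [ObjectProperty.Small.{w} P] :
    ObjectProperty.EssentiallySmall.{w} (coneCoproductClosure lam P) := by
  have : P ≤ ⨆ o, closureIter lam P o := by
    have : Nonempty lam.ord.ToType := by
      rw [← Cardinal.mk_ne_zero_iff, Cardinal.mk_ord_toType]
      exact hlam.pos.ne'
    refine le_trans ?_ (le_iSup _ (Classical.arbitrary lam.ord.ToType))
    rw [closureIter_eq]
    exact le_sup_left.trans le_sup_left
  exact ⟨⨆ o, closureIter lam P o, inferInstance, fun X hX =>
    hX _ (this.trans (ObjectProperty.le_isoClosure _))
      (isConeCoproductClosed_iSup_closureIter P hlam)⟩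

end Small

end WellGenerated

/-! ### Factoring maps into coproducts through small pieces. -/

open scoped ZeroObject

namespace WellGenerated

section Shift

variable {T : Type u} [Category.{w} T] [HasShift T ℤ]

/-- Morphisms out of a shift are morphisms to the opposite shift. -/
noncomputable def shiftHomEquiv (n : ℤ) (X Y : T) : (X⟦n⟧ ⟶ Y) ≃ (X ⟶ Y⟦-n⟧) :=
  (shiftEquiv T n).toAdjunction.homEquiv X Y

lemma shiftHomEquiv_comp (n : ℤ) {X Y Z : T} (f : X⟦n⟧ ⟶ Y) (g : Y ⟶ Z) :
    shiftHomEquiv n X Z (f ≫ g) = shiftHomEquiv n X Y f ≫ g⟦-n⟧' :=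
  (shiftEquiv T n).toAdjunction.homEquiv_naturality_right f g

lemma shiftHomEquiv_symm_comp (n : ℤ) {X Y Z : T} (f : X ⟶ Y⟦-n⟧) (g : Y ⟶ Z) :
    (shiftHomEquiv n X Z).symm (f ≫ g⟦-n⟧') = (shiftHomEquiv n X Y).symm f ≫ g :=
  (shiftEquiv T n).toAdjunction.homEquiv_naturality_right_symm f g

lemma shiftHomEquiv_symm_comp_left (n : ℤ) {X Y Z : T} (f : X ⟶ Y) (g : Y ⟶ Z⟦-n⟧) :
    (shiftHomEquiv n X Z).symm (f ≫ g) = f⟦n⟧' ≫ (shiftHomEquiv n Y Z).symm g :=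
  (shiftEquiv T n).toAdjunction.homEquiv_naturality_left_symm f g

end Shift

variable {T : Type u} [Category.{w} T] [HasZeroObject T] [HasShift T ℤ] [Preadditive T]
  [∀ n : ℤ, (shiftFunctor T n).Additive] [Pretriangulated T] [HasCoproducts.{w} T]

lemma IsPerfect.shifts {κ : Type w} {G : κ → T} (hG : IsPerfect G) :
    IsPerfect fun x : κ × ℤ => (G x.1)⟦x.2⟧ := by
  rintro I X Y f hf ⟨k, n⟩ (g : (G k)⟦n⟧ ⟶ ∐ Y)
  have h (i) : IsSurjOn G ((f i)⟦-n⟧') := fun k g => by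
    obtain ⟨g', hg'⟩ := hf i (k, n) ((shiftHomEquiv n _ _).symm g)
    exact ⟨shiftHomEquiv n _ _ g', by rw [← shiftHomEquiv_comp, hg', Equiv.apply_symm_apply]⟩
  obtain ⟨g', hg'⟩ := hG I _ _ _ h k (shiftHomEquiv n _ _ g ≫ (shiftSigmaIso Y (-n)).inv)
  refine ⟨(shiftHomEquiv n _ _).symm (g' ≫ (shiftSigmaIso X (-n)).hom), ?_⟩
  rw [← shiftHomEquiv_symm_comp, Equiv.symm_apply_eq, Category.assoc,
    ← shiftSigmaIso_hom_naturality, ← Category.assoc, hg', Category.assoc, Iso.inv_hom_id,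
    Category.comp_id]

lemma IsCardinalSmall.shift {μ : Cardinal.{w}} {X : T} (hX : IsCardinalSmall μ X) (n : ℤ) :
    IsCardinalSmall μ (X⟦n⟧) := by
  intro I Y f
  obtain ⟨J, hJ, g, hg⟩ := hX I _ (shiftHomEquiv n _ _ f ≫ (shiftSigmaIso Y (-n)).inv)
  refine ⟨J, hJ, (shiftHomEquiv n _ _).symm
    (g ≫ (shiftSigmaIso (fun j : J => Y j) (-n)).hom), ?_⟩
  have : (shiftSigmaIso (fun j : J => Y j) (-n)).hom ≫
      (Sigma.desc fun j : J => Sigma.ι Y j)⟦-n⟧' =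
      (Sigma.desc fun j : J => Sigma.ι (fun i => (Y i)⟦-n⟧) j) ≫ (shiftSigmaIso Y (-n)).hom :=
    Sigma.hom_ext _ _ fun j => by simp [← Functor.map_comp]
  rw [← shiftHomEquiv_symm_comp, Equiv.symm_apply_eq, Category.assoc, this, ← Category.assoc, hg,
    Category.assoc, Iso.inv_hom_id, Category.comp_id]

section

variable {lam : Cardinal.{w}} {P : ObjectProperty T} (hP : IsConeCoproductClosed lam P)

include hP

lemma IsConeCoproductClosed.of_isZero (hlam : lam.IsRegular) {X : T} (hX : IsZero X) : P X := by
  have h₀ : IsZero (∐ (PEmpty.elim : PEmpty.{w + 1} → T)) := by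
    rw [IsZero.iff_id_eq_zero]
    exact Sigma.hom_ext _ _ fun i => i.elim
  have h := hP.coproduct (by simpa using hlam.pos) (PEmpty.elim : PEmpty.{w + 1} → T)
    fun i => i.elim
  exact hP.cone (isomorphic_distinguished _ (contractible_distinguished₁ (0 : T)) _
    (Triangle.isoMk (Triangle.mk (0 : (∐ (PEmpty.elim : PEmpty.{w + 1} → T)) ⟶
      ∐ (PEmpty.elim : PEmpty.{w + 1} → T)) (0 : _ ⟶ X) 0) _ (h₀.iso (isZero_zero T))
      (h₀.iso (isZero_zero T)) (hX.iso (isZero_zero T)) (h₀.eq_of_src _ _) (h₀.eq_of_src _ _)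
      (hX.eq_of_src _ _))) h h

lemma IsConeCoproductClosed.isClosedUnderIsomorphisms (hlam : lam.IsRegular) :
    P.IsClosedUnderIsomorphisms where
  of_iso {X Y} e hX := by
    refine hP.cone (isomorphic_distinguished _ (contractible_distinguished₁ X) _
      (Triangle.isoMk (Triangle.mk (0 : 0 ⟶ X) e.hom 0) _ (Iso.refl _)
        (Iso.refl _) e.symm ?_ ?_ ?_)) (hP.of_isZero hlam (isZero_zero T)) hX
    · simp [Triangle.mk]
    · simp [Triangle.mk]
    · simp [Triangle.mk]

lemma IsConeCoproductClosed.coproduct_of_support (hlam : lam.IsRegular) {I : Type w} {J : Set I}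
    (hJ : Cardinal.mk J < lam) (X : I → T) (hX : ∀ i, P (X i)) (h₀ : ∀ i ∉ J, IsZero (X i)) :
    P (∐ X) := by
  have := hP.isClosedUnderIsomorphisms hlam
  classical
  refine P.prop_of_iso (?_ : (∐ fun j : J => X j) ≅ _) (hP.coproduct hJ _ fun j => hX j)
  exact
    { hom := Sigma.desc fun j => Sigma.ι X j
      inv := Sigma.desc fun i => if h : i ∈ J then Sigma.ι (fun j : J => X j) ⟨i, h⟩ else 0
      hom_inv_id := Sigma.hom_ext _ _ fun j => by simp
      inv_hom_id := Sigma.hom_ext _ _ fun i => by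
        by_cases hi : i ∈ J
        · simp [hi]
        · exact (h₀ i hi).eq_of_src _ _ }

end

section Shift

variable {lam : Cardinal.{w}} (hlam : lam.IsRegular) {P : ObjectProperty T}
  (hP : ∀ X, P X → ∀ n : ℤ, coneCoproductClosure lam P (X⟦n⟧))

include hlam hP

lemma coneCoproductClosure_shift (X : T) (hX : coneCoproductClosure lam P X) (n : ℤ) :
    coneCoproductClosure lam P (X⟦n⟧) := by
  have hC := isConeCoproductClosed_closure lam P
  have := hC.isClosedUnderIsomorphisms hlam
  exact hX (fun X => coneCoproductClosure lam P (X⟦n⟧))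
    (fun X hX => hP X hX n)
    { cone hT hX hY := hC.cone (Triangle.shift_distinguished _ hT n) hX hY
      coproduct hI X hX :=
        ObjectProperty.prop_of_iso _ (shiftSigmaIso X n) (hC.coproduct hI _ hX) }

lemma isTriangulated_coneCoproductClosure : (coneCoproductClosure lam P).IsTriangulated :=
  have hC := isConeCoproductClosed_closure lam P
  have := hC.isClosedUnderIsomorphisms hlam
  { exists_zero := ⟨0, isZero_zero T, hC.of_isZero hlam (isZero_zero T)⟩
    isStableUnderShiftBy n := ⟨fun X hX => coneCoproductClosure_shift hlam hP X hX n⟩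
    toIsTriangulatedClosed₂ := .mk' fun _ ht h₁ h₃ =>
      hC.cone (inv_rot_of_distTriang _ ht) (coneCoproductClosure_shift hlam hP _ h₃ (-1)) h₁ }

end Shift

/-- Every morphism from `X` to a small coproduct factors through a coproduct of morphisms
with fewer than `lam` nonzero sources, all satisfying `P`. -/
def FactorsThroughCoproducts (lam : Cardinal.{w}) (P : ObjectProperty T) : ObjectProperty T :=
  fun X => ∀ (I : Type w) (Y : I → T) (f : X ⟶ ∐ Y),
    ∃ (J : Set I) (Z : I → T) (φ : ∀ i, Z i ⟶ Y i) (g : X ⟶ ∐ Z), Cardinal.mk J < lam ∧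
      (∀ i, P (Z i)) ∧ (∀ i ∉ J, IsZero (Z i)) ∧ g ≫ Limits.Sigma.map φ = f

lemma FactorsThroughCoproducts.shift {lam : Cardinal.{w}} {P : ObjectProperty T}
    (hP : ∀ X, P X → ∀ n : ℤ, P (X⟦n⟧)) {X : T} (hX : FactorsThroughCoproducts lam P X) (n : ℤ) :
    FactorsThroughCoproducts lam P (X⟦n⟧) := by
  intro I Y f
  obtain ⟨J, Z, φ, g, hJ, hZ, h₀, hg⟩ :=
    hX I _ (shiftHomEquiv n _ _ f ≫ (shiftSigmaIso Y (-n)).inv)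
  refine ⟨J, fun i => (Z i)⟦n⟧, fun i => (shiftHomEquiv n _ _).symm (φ i),
    g⟦n⟧' ≫ (shiftSigmaIso Z n).inv, hJ, fun i => hP _ (hZ i) n,
    fun i hi => (shiftFunctor T n).map_isZero (h₀ i hi), ?_⟩
  have h₁ : (shiftSigmaIso Z n).inv ≫ Limits.Sigma.map (fun i => (shiftHomEquiv n _ _).symm (φ i)) =
      (shiftHomEquiv n _ _).symm (Limits.Sigma.map φ ≫ (shiftSigmaIso Y (-n)).hom) := by
    rw [Iso.inv_comp_eq]
    refine Sigma.hom_ext _ _ fun i => ?_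
    rw [Sigma.ι_map, ι_shiftSigmaIso_hom_assoc, ← shiftHomEquiv_symm_comp,
      ← shiftHomEquiv_symm_comp_left, Sigma.ι_map_assoc, ι_shiftSigmaIso_hom]
  rw [Category.assoc, h₁, ← shiftHomEquiv_symm_comp_left, ← Category.assoc, hg, Category.assoc,
    Iso.inv_hom_id, Category.comp_id, Equiv.symm_apply_apply]

/-- Covering each `Y i` by all maps from generators is surjective on `G`, so by perfectness `f`
lifts to the coproduct of the covers. Smallness of `G k` leaves fewer than `μ` summands, which are
regrouped by `i`. -/
lemma factorsThroughCoproducts_of_isPerfect {lam : Cardinal.{w}} {P : ObjectProperty T}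
    (hP : IsConeCoproductClosed lam P) {κ : Type w} {G : κ → T} (hG : IsPerfect G)
    (hGP : ∀ k, P (G k)) {μ : Cardinal.{w}} (hμ : μ ≤ lam)
    (hGμ : ∀ k, IsCardinalSmall μ (G k)) (k : κ) :
    FactorsThroughCoproducts lam P (G k) := by
  intro I Y f
  obtain ⟨g₀, hg₀⟩ := hG I (fun i => ∐ fun x : Σ k, G k ⟶ Y i => G x.1) Y
    (fun i => Sigma.desc fun x => x.2) (fun i k g => ⟨Sigma.ι (fun x : Σ k, G k ⟶ Y i => G x.1)
      ⟨k, g⟩, by simp⟩) k f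
  let K : (Σ i, Σ k, G k ⟶ Y i) → T := fun z => G z.2.1
  obtain ⟨J, hJ, g₁, hg₁⟩ := hGμ k _ K (g₀ ≫ Sigma.desc fun i => Sigma.desc fun x =>
    Sigma.ι K ⟨i, x⟩)
  have hle (i : I) : Cardinal.mk { x // (⟨i, x⟩ : Σ i, Σ k, G k ⟶ Y i) ∈ J } ≤ Cardinal.mk J :=
    Cardinal.mk_le_of_injective (f := fun x => ⟨_, x.2⟩) fun x y hxy => by
      ext1
      simpa using hxy
  refine ⟨Sigma.fst '' J, fun i => ∐ fun x : { x // (⟨i, x⟩ : Σ i, Σ k, G k ⟶ Y i) ∈ J } =>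
    G x.1.1, fun i => Sigma.desc fun x => x.1.2, g₁ ≫ Sigma.desc fun j =>
      Sigma.ι (fun x : { x // (⟨j.1.1, x⟩ : Σ i, Σ k, G k ⟶ Y i) ∈ J } => G x.1.1) ⟨j.1.2, j.2⟩ ≫
        Sigma.ι (fun i => ∐ fun x : { x // (⟨i, x⟩ : Σ i, Σ k, G k ⟶ Y i) ∈ J } => G x.1.1) j.1.1,
    Cardinal.mk_image_le.trans_lt (hJ.trans_le hμ),
    fun i => hP.coproduct ((hle i).trans_lt (hJ.trans_le hμ)) _ fun x => hGP _,
    fun i hi => ?_, ?_⟩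
  · rw [IsZero.iff_id_eq_zero]
    exact Sigma.hom_ext _ _ fun x => (hi ⟨_, x.2, rfl⟩).elim
  · let p : ∐ K ⟶ ∐ Y := Sigma.desc fun z => z.2.2 ≫ Sigma.ι Y z.1
    have h₁ := hg₁ =≫ p
    have h₂ : (Sigma.desc fun i => Sigma.desc fun x => Sigma.ι K ⟨i, x⟩) ≫ p =
        Limits.Sigma.map fun i => Sigma.desc fun x : Σ k, G k ⟶ Y i => x.2 :=
      Sigma.hom_ext _ _ fun i => Sigma.hom_ext _ _ fun x => by
        simp only [Sigma.ι_map, Sigma.ι_desc_assoc, Sigma.ι_desc, p]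
    rw [Category.assoc, Category.assoc, h₂, hg₀] at h₁
    rw [← h₁, Category.assoc]
    congr 1
    exact Sigma.hom_ext _ _ fun j => by simp [p]

/-- For a cone `E` of `D ⟶ C`, factor the restriction of `f` to `C` through objects `Z i`. The
induced map from `D` lands in the fibers of `Z i ⟶ Y i`, and is factored through objects `V i`. The
cones of `V i ⟶ Z i` then receive a map from `E`. -/
lemma isConeCoproductClosed_factorsThroughCoproducts {lam : Cardinal.{w}} (hlam : lam.IsRegular)
    {P : ObjectProperty T} (hP : IsConeCoproductClosed lam P) (hP' : ∀ X, P X → ∀ n : ℤ, P (X⟦n⟧)) :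
    IsConeCoproductClosed lam (FactorsThroughCoproducts lam P) where
  coproduct {A} hA X hX I Y f := by
    choose J Z φ g hJ hZ h₀ hg using fun a => hX a I Y (Sigma.ι X a ≫ f)
    refine ⟨⋃ a, J a, fun i => ∐ fun a => Z a i, fun i => Sigma.desc fun a => φ a i,
      Sigma.desc fun a => g a ≫ Limits.Sigma.map fun i => Sigma.ι (fun a => Z a i) a, ?_,
      fun i => hP.coproduct hA _ fun a => hZ a i, fun i hi => ?_, ?_⟩
    · have : Fact lam.IsRegular := ⟨hlam⟩
      rw [← hasCardinalLT_iff_cardinal_mk_lt] at hA ⊢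
      exact hasCardinalLT_iUnion _ hA fun a => by
        rw [hasCardinalLT_iff_cardinal_mk_lt]
        exact hJ a
    · rw [IsZero.iff_id_eq_zero]
      simp only [Set.mem_iUnion, not_exists] at hi
      exact Sigma.hom_ext _ _ fun a => (h₀ a i (hi a)).eq_of_src _ _
    · refine Sigma.hom_ext _ _ fun a => ?_
      rw [← hg a, Sigma.ι_desc_assoc, Category.assoc]
      congr 1
      exact Sigma.hom_ext _ _ fun i => by simp
  cone {D C E a b c} hT hD hC I Y f := by
    have hab : a ≫ b = 0 := comp_distTriang_mor_zero₁₂ _ hT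
    obtain ⟨J₁, Z, φ, g, hJ₁, hZ, hZ₀, hg⟩ := hC I Y (b ≫ f)
    choose W v δ hW using fun i => distinguished_cocone_triangle₁ (φ i)
    have hvφ (i) : v i ≫ φ i = 0 := comp_distTriang_mor_zero₁₂ _ (hW i)
    obtain ⟨d, hd⟩ := sigma_weak_kernel v φ δ hW (a ≫ g)
      (by rw [Category.assoc, hg, reassoc_of% hab, zero_comp])
    obtain ⟨J₂, V, ψ, d', hJ₂, hV, hV₀, hd'⟩ := hD I W d
    choose φ' hφ' using fun i => exists_coneMap_comp (ψ i ≫ v i) (φ i)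
      (by rw [Category.assoc, hvφ, comp_zero])
    let m (i) : Z i ⟶ coneObj (ψ i ≫ v i) := coneMap _
    obtain ⟨h, hh⟩ : ∃ h : E ⟶ ∐ fun i => coneObj (ψ i ≫ v i), g ≫ Limits.Sigma.map m = b ≫ h :=
      Triangle.yoneda_exact₂ _ hT _ (by
        change a ≫ g ≫ _ = 0
        have : Limits.Sigma.map ψ ≫ Limits.Sigma.map v ≫ Limits.Sigma.map m = 0 :=
          Sigma.hom_ext _ _ fun i => by
            have := comp_coneMap (ψ i ≫ v i)
            rw [Category.assoc] at this
            simp [m, reassoc_of% this]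
        rw [← Category.assoc, ← hd, ← hd', Category.assoc, Category.assoc, this, comp_zero])
    obtain ⟨q, hq⟩ : ∃ q : D⟦(1 : ℤ)⟧ ⟶ ∐ Y, f - h ≫ Limits.Sigma.map φ' = c ≫ q :=
      Triangle.yoneda_exact₃ _ hT _ (by
        change b ≫ _ = 0
        have : Limits.Sigma.map m ≫ Limits.Sigma.map φ' = Limits.Sigma.map φ :=
          Sigma.hom_ext _ _ fun i => by simp [m, reassoc_of% (hφ' i)]
        rw [Preadditive.comp_sub, ← hg, ← reassoc_of% hh, this, sub_self])
    -- The map through the cones agrees with `f` only on `C`; the error comes from `D⟦1⟧` and is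
    -- absorbed by the extra summands `U i`.
    obtain ⟨J₃, U, χ, q', hJ₃, hU, hU₀, hq'⟩ := hD.shift hP' 1 I Y q
    refine ⟨J₁ ∪ J₂ ∪ J₃, fun i => coneObj (ψ i ≫ v i) ⊞ U i,
      fun i => biprod.desc (φ' i) (χ i), h ≫ Limits.Sigma.map (fun i => biprod.inl) +
        c ≫ q' ≫ Limits.Sigma.map fun i => biprod.inr, ?_, fun i => ?_, fun i hi => ?_, ?_⟩
    · have hl := hlam.aleph0_le
      exact (Cardinal.mk_union_le _ _).trans_lt (Cardinal.add_lt_of_lt hl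
        ((Cardinal.mk_union_le _ _).trans_lt (Cardinal.add_lt_of_lt hl hJ₁ hJ₂)) hJ₃)
    · exact hP.cone (inv_rot_of_distTriang _ (binaryBiproductTriangle_distinguished _ _))
        (hP' _ (hU i) (-1)) (hP.cone (cone_distinguished (ψ i ≫ v i)) (hV i) (hZ i))
    · simp only [Set.mem_union, not_or] at hi
      rw [biprod_isZero_iff]
      exact ⟨Triangle.isZero₃_of_isZero₁₂ _ (cone_distinguished (ψ i ≫ v i)) (hV₀ i hi.1.2)
        (hZ₀ i hi.1.1), hU₀ i hi.2⟩
    · have h₁ : (Limits.Sigma.map fun i => (biprod.inl : _ ⟶ coneObj (ψ i ≫ v i) ⊞ U i)) ≫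
          (Limits.Sigma.map fun i => biprod.desc (φ' i) (χ i)) = Limits.Sigma.map φ' :=
        Sigma.hom_ext _ _ fun i => by simp
      have h₂ : (Limits.Sigma.map fun i => (biprod.inr : _ ⟶ coneObj (ψ i ≫ v i) ⊞ U i)) ≫
          (Limits.Sigma.map fun i => biprod.desc (φ' i) (χ i)) = Limits.Sigma.map χ :=
        Sigma.hom_ext _ _ fun i => by simp
      rw [Preadditive.add_comp, Category.assoc, Category.assoc, Category.assoc, h₁, h₂, hq', ← hq,
        add_sub_cancel]

end WellGenerated

/-! ### Exact filtered colimits and filtered slices. -/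

namespace WellGenerated

section ExactColimits

lemma HasExactCardinalFilteredColimits.of_essentiallySmall {A : Type u'} [Category.{w} A]
    {α : Cardinal.{w}} [Fact α.IsRegular] (hA : HasExactCardinalFilteredColimits A α)
    (J : Type*) [Category* J] [EssentiallySmall.{w} J] [IsCardinalFiltered J α] :
    ∃ _ : HasColimitsOfShape J A, HasExactColimitsOfShape J A := by
  have := IsCardinalFiltered.of_equivalence α (equivSmallModel.{w} J)
  obtain ⟨h, h'⟩ := hA (SmallModel.{w} J)
  exact ⟨hasColimitsOfShape_of_equivalence (equivSmallModel.{w} J).symm,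
    .of_domain_equivalence _ (equivSmallModel.{w} J).symm⟩

attribute [local instance] IsFiltered.isConnected

/-- In a filtered colimit, a morphism to a term which vanishes in the colimit is locally annihilated
by a transition morphism. -/
lemma eq_zero_of_comp_ι_eq_zero {A : Type*} [Category* A] [Abelian A] {J : Type*} [Category* J]
    [IsFiltered J] {F : J ⥤ A} {c : Cocone F} (hc : IsColimit c) (j : J)
    [HasColimitsOfShape (Under j) A] [HasExactColimitsOfShape (Under j) A]
    {W B : A} (x : W ⟶ F.obj j) (hx : x ≫ c.ι.app j = 0) (t : W ⟶ B)
    (ht : ∀ ⦃k : J⦄ (u : j ⟶ k) ⦃V : A⦄ (q : V ⟶ W), q ≫ x ≫ F.map u = 0 → q ≫ t = 0) :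
    t = 0 := by
  -- By exactness, the kernels of `W ⟶ F.obj k` have as colimit an object mapping epimorphically
  -- onto the kernel of `W ⟶ c.pt`, which is all of `W`.
  let ξ : (Functor.const (Under j)).obj W ⟶ Under.forget j ⋙ F :=
    { app k := x ≫ F.map k.hom
      naturality k l g := by
        have := Under.w g
        dsimp
        rw [Category.id_comp, Category.assoc, ← F.map_comp, this] }
  let S : ShortComplex (Under j ⥤ A) := .mk (kernel.ι ξ) ξ (kernel.condition ξ)
  have hS : S.Exact := S.exact_of_f_is_kernel (kernelIsKernel ξ)
  let d : colimit (kernel ξ) ⟶ W := colimit.desc (kernel ξ) ⟨W, kernel.ι ξ⟩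
  have hf (k) : colimit.ι (kernel ξ) k ≫ d = (kernel.ι ξ).app k := by
    simp [d]
  have h := colim.exact_mapShortComplex (S := S) hS (colimit.isColimit _)
    (c₂ := constCocone _ W) (isColimitConstCocone _ W)
    (c₃ := c.whisker (Under.forget j)) ((Functor.Final.isColimitWhiskerEquiv _ _).symm hc)
    d (0 : W ⟶ c.pt) (fun k => (hf k).trans (Category.comp_id _).symm) (fun k => by
      change 𝟙 W ≫ (0 : W ⟶ c.pt) = (x ≫ F.map k.hom) ≫ c.ι.app k.right
      rw [comp_zero, Category.assoc]
      exact ((x ≫= c.w k.hom).trans hx).symm)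
  have : Epi d := h.epi_f rfl
  rw [← cancel_epi d, comp_zero]
  refine colimit.hom_ext fun k => ?_
  rw [comp_zero, ← Category.assoc, hf]
  refine ht k.hom _ ?_
  exact NatTrans.congr_app (kernel.condition ξ) k

end ExactColimits

section

variable {T : Type u} [Category.{w} T] [HasZeroObject T] [HasShift T ℤ] [Preadditive T]
  [∀ n : ℤ, (shiftFunctor T n).Additive] [Pretriangulated T] [HasCoproducts.{w} T]

/-- Coproducts bound families of objects; the cone of the differences `f i - f i₀` coequalizes a
family of parallel maps. -/
lemma isCardinalFiltered_costructuredArrow {lam : Cardinal.{w}} [hlam : Fact lam.IsRegular]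
    {P : ObjectProperty T} (hP : IsConeCoproductClosed lam P) (X : T) :
    IsCardinalFiltered (CostructuredArrow P.ι X) lam := by
  rw [isCardinalFiltered_iff]
  have hmax ⦃I : Type w⦄ (j : I → CostructuredArrow P.ι X) (hI : HasCardinalLT I lam) :
      ∃ k, ∀ i, Nonempty (j i ⟶ k) := by
    rw [hasCardinalLT_iff_cardinal_mk_lt] at hI
    let Z : P.FullSubcategory := ⟨∐ fun i => (j i).left.obj, hP.coproduct hI _ fun i => (j i).left.2⟩
    exact ⟨CostructuredArrow.mk (Y := Z) (show P.ι.obj Z ⟶ X from Sigma.desc fun i => (j i).hom),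
      fun i => ⟨CostructuredArrow.homMk (P.homMk (Sigma.ι (fun i => (j i).left.obj) i))
        (Sigma.ι_desc _ _)⟩⟩
  refine ⟨hmax, fun I j k f hI => ?_⟩
  obtain hne | ⟨⟨i₀⟩⟩ := isEmpty_or_nonempty I
  · obtain ⟨l, hl⟩ := hmax (fun b : ULift Bool => bif b.down then j else k)
      (hasCardinalLT_of_finite _ _ hlam.out.aleph0_le)
    exact ⟨l, (hl ⟨false⟩).some, (hl ⟨true⟩).some, fun i => hne.elim i⟩
  · rw [hasCardinalLT_iff_cardinal_mk_lt] at hI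
    let d : (∐ fun _ : I => j.left.obj) ⟶ k.left.obj :=
      Sigma.desc fun i => (f i).left.hom - (f i₀).left.hom
    obtain ⟨e, he⟩ := exists_coneMap_comp d k.hom (Sigma.hom_ext _ _ fun i => by
      have h₁ := CostructuredArrow.w (f i)
      have h₂ := CostructuredArrow.w (f i₀)
      dsimp at h₁ h₂
      simp [d, h₁, h₂])
    let Z : P.FullSubcategory := ⟨coneObj d, hP.cone (cone_distinguished d)
      (hP.coproduct hI _ fun _ => j.left.2) k.left.2⟩
    let a : k ⟶ CostructuredArrow.mk (Y := Z) (show P.ι.obj Z ⟶ X from e) :=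
      CostructuredArrow.homMk (P.homMk (coneMap d)) he
    refine ⟨_, a, f i₀ ≫ a, fun i => ?_⟩
    ext
    have := Sigma.ι (fun _ : I => j.left.obj) i ≫= comp_coneMap d
    simpa [d, a, sub_eq_zero] using this

end

end WellGenerated

/-! ### The Kan extension of `H` from `P`. -/

namespace WellGenerated

section Homological

variable {T : Type u} [Category.{w} T] [HasZeroObject T] [HasShift T ℤ] [Preadditive T]
  [∀ n : ℤ, (shiftFunctor T n).Additive] [Pretriangulated T]
  {A : Type u'} [Category.{w} A] [Abelian A]

open ComposableArrows in
lemma exact_composableArrows_of_isHomological (F : T ⥤ A) [F.IsHomological] (t : Triangle T)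
    (ht : t ∈ distTriang T) :
    (mk₄ (F.map t.invRotate.mor₁) (F.map t.mor₁) (F.map t.mor₂) (F.map t.mor₃)).Exact :=
  exact_of_δ₀ (F.map_distinguished_exact _ (inv_rot_of_distTriang _ ht)).exact_toComposableArrows
    (exact_of_δ₀ (F.map_distinguished_exact _ ht).exact_toComposableArrows
      (F.map_distinguished_exact _ (rot_of_distTriang _ ht)).exact_toComposableArrows)

open ComposableArrows in
lemma isIso_app_of_isHomological {F G : T ⥤ A} [F.IsHomological] [G.IsHomological] (θ : F ⟶ G)
    (t : Triangle T) (ht : t ∈ distTriang T) (h₁ : IsIso (θ.app t.obj₁))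
    (h₃ : IsIso (θ.app t.obj₃)) (h₃' : IsIso (θ.app (t.obj₃⟦(-1 : ℤ)⟧)))
    (h₁' : IsIso (θ.app (t.obj₁⟦(1 : ℤ)⟧))) : IsIso (θ.app t.obj₂) :=
  Abelian.isIso_of_epi_of_isIso_of_isIso_of_mono
    (exact_composableArrows_of_isHomological F t ht)
    (exact_composableArrows_of_isHomological G t ht)
    (homMk₄ (θ.app t.invRotate.obj₁) (θ.app t.obj₁) (θ.app t.obj₂) (θ.app t.obj₃)
      (θ.app (t.obj₁⟦(1 : ℤ)⟧)) (θ.naturality _) (θ.naturality _) (θ.naturality _)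
      (θ.naturality _)) (inferInstanceAs (Epi (θ.app (t.obj₃⟦(-1 : ℤ)⟧)))) h₁ h₃
    (inferInstanceAs (Mono (θ.app (t.obj₁⟦(1 : ℤ)⟧))))

variable {P : ObjectProperty T} {H F : T ⥤ A} {η : P.ι ⋙ H ⟶ P.ι ⋙ F}
  (hF : (Functor.LeftExtension.mk F η).IsPointwiseLeftKanExtension)

include hF

/-- Exact colimits are compatible with pullback along `y`, so a generalized element of `F.obj X`
comes locally from some `H.obj C`. -/
lemma comp_eq_zero_of_isPointwiseLeftKanExtension (X : T) [IsConnected (CostructuredArrow P.ι X)]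
    [HasColimitsOfShape (CostructuredArrow P.ι X) A]
    [HasExactColimitsOfShape (CostructuredArrow P.ι X) A] {W B : A} (y : W ⟶ F.obj X)
    (t : F.obj X ⟶ B)
    (h : ∀ (C : P.FullSubcategory) (c : C.obj ⟶ X) ⦃V : A⦄ (q : V ⟶ W) (r : V ⟶ H.obj C.obj),
      r ≫ η.app C ≫ F.map c = q ≫ y → r ≫ η.app C ≫ F.map c ≫ t = 0) : y ≫ t = 0 := by
  refine (hF X).pullback_zero_ext fun j => ?_
  have := pullback.condition (f := ((Functor.LeftExtension.mk F η).coconeAt X).ι.app j) (g := y)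
  exact (Category.assoc _ _ _).symm.trans ((this.symm =≫ t).trans ((Category.assoc _ _ _).trans
    ((_ ≫= Category.assoc _ _ _).trans (h j.left j.hom _ _ this))))

lemma hom_ext_of_isPointwiseLeftKanExtension {X : T} {B : A} {s t : F.obj X ⟶ B}
    (h : ∀ (C : P.FullSubcategory) (c : C.obj ⟶ X),
      η.app C ≫ F.map c ≫ s = η.app C ≫ F.map c ≫ t) : s = t :=
  (hF X).hom_ext fun j =>
    (Category.assoc _ _ _).trans ((h j.left j.hom).trans (Category.assoc _ _ _).symm)

/-- An element of the kernel comes locally from `r` in `H C`, and dies in `H C'` for some `u' : C ⟶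
C'` over `t.obj₃`. The fiber `D` of `u'` is in `P` and `r` lifts locally to `H D`. As `D ⟶ C ⟶
t.obj₂` dies in `t.obj₃`, it factors through `t.obj₁`, so `r` vanishes in the cokernel. -/
lemma isHomological_of_isPointwiseLeftKanExtension [H.IsHomological] [P.IsTriangulated]
    [∀ X, IsFiltered (CostructuredArrow P.ι X)]
    (h₁ : ∀ X, ∃ _ : HasColimitsOfShape (CostructuredArrow P.ι X) A,
      HasExactColimitsOfShape (CostructuredArrow P.ι X) A)
    (h₂ : ∀ (X) (j : CostructuredArrow P.ι X), ∃ _ : HasColimitsOfShape (Under j) A,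
      HasExactColimitsOfShape (Under j) A) : F.IsHomological where
  map_zero X Y := hom_ext_of_isPointwiseLeftKanExtension hF fun C c => by
    have h := η.naturality (P.homMk (0 : C.obj ⟶ C.obj))
    replace h : η.app C ≫ F.map (0 : C.obj ⟶ C.obj) = 0 :=
      h.symm.trans ((congrArg (· ≫ η.app C) (H.map_zero _ _)).trans zero_comp)
    have h' : c ≫ (0 : X ⟶ Y) = (0 : C.obj ⟶ C.obj) ≫ (0 : C.obj ⟶ Y) := by simp
    rw [← F.map_comp, h', F.map_comp, reassoc_of% h, zero_comp, comp_zero, comp_zero]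
  exact t ht := by
    rw [ShortComplex.exact_iff_kernel_ι_comp_cokernel_π_zero]
    obtain ⟨_, _⟩ := h₁ t.obj₂
    have := IsFiltered.isConnected (CostructuredArrow P.ι t.obj₂)
    change kernel.ι (F.map t.mor₂) ≫ cokernel.π (F.map t.mor₁) = 0
    refine comp_eq_zero_of_isPointwiseLeftKanExtension hF _ _ _ fun C c V q r hr => ?_
    let j : CostructuredArrow P.ι t.obj₃ := CostructuredArrow.mk (Y := C) (c ≫ t.mor₂)
    obtain ⟨_, _⟩ := h₂ t.obj₃ j
    have hr₀ : (r ≫ η.app C ≫ F.map c) ≫ F.map t.mor₂ = 0 := by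
      rw [hr, Category.assoc]
      exact (q ≫= kernel.condition (F.map t.mor₂)).trans comp_zero
    refine eq_zero_of_comp_ι_eq_zero (hF t.obj₃) j r ?_ _ fun k u V q hq => ?_
    · refine Eq.trans ?_ hr₀
      change r ≫ η.app C ≫ F.map (c ≫ t.mor₂) = _
      simp only [Category.assoc, Functor.map_comp]
    · let u' : C.obj ⟶ k.left.obj := u.left.hom
      obtain ⟨D, v, δ, hD, hPD⟩ : ∃ (D : T) (v : D ⟶ C.obj) (δ : k.left.obj ⟶ D⟦(1 : ℤ)⟧),
          Triangle.mk v u' δ ∈ distTriang T ∧ P D := by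
        obtain ⟨D, hPD, v, δ, hD⟩ := P.distinguished_cocone_triangle₁ u' C.2 k.left.2
        exact ⟨D, v, δ, hD, hPD⟩
      obtain ⟨w, hw⟩ : ∃ w : D ⟶ t.obj₁, v ≫ c = w ≫ t.mor₁ :=
        Triangle.coyoneda_exact₂ _ ht _ (by
          have h : u' ≫ k.hom = c ≫ t.mor₂ := CostructuredArrow.w u
          have h' : v ≫ u' = 0 := comp_distTriang_mor_zero₁₂ _ hD
          rw [Category.assoc, ← h, reassoc_of% h', zero_comp])
      replace hq : (q ≫ r) ≫ H.map u' = 0 := (Category.assoc _ _ _).trans hq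
      obtain ⟨V', e, _, z, hz⟩ : ∃ (V' : A) (e : V' ⟶ V) (_ : Epi e) (z : V' ⟶ H.obj D),
          e ≫ q ≫ r = z ≫ H.map v :=
        (H.map_distinguished_exact _ hD).exact_up_to_refinements (q ≫ r) hq
      have hη : H.map v ≫ η.app C = η.app ⟨D, hPD⟩ ≫ F.map v :=
        η.naturality (P.homMk v : (⟨D, hPD⟩ : P.FullSubcategory) ⟶ C)
      rw [← cancel_epi e, comp_zero]
      rw [reassoc_of% hz, reassoc_of% hη, ← F.map_comp_assoc, hw, F.map_comp, Category.assoc,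
        cokernel.condition, comp_zero, comp_zero, comp_zero]

end Homological

section

variable {T : Type u} [Category.{w} T] [HasZeroObject T] [HasShift T ℤ] [Preadditive T]
  [∀ n : ℤ, (shiftFunctor T n).Additive] [Pretriangulated T] [HasCoproducts.{w} T]
  {A : Type u'} [Category.{w} A] [Abelian A]

lemma sigma_hom_ext_of_preserves {H : T ⥤ A}
    (hH : ∀ I : Type w, PreservesColimitsOfShape (Discrete I) H) {I : Type w} {X : I → T} {B : A}
    {s t : H.obj (∐ X) ⟶ B}
    (h : ∀ i, H.map (Sigma.ι X i) ≫ s = H.map (Sigma.ι X i) ≫ t) : s = t := by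
  have := hH I
  exact (isColimitOfPreserves H (coproductIsCoproduct X)).hom_ext fun ⟨i⟩ => h i

/-- A map from `C` in `P` to `∐ X` factors through some `∐ Z` in `P` with all `Z i` in `P`, where
the preservation of coproducts by `H` reduces the claim to the summands. -/
lemma sigma_hom_ext_of_isPointwiseLeftKanExtension {lam : Cardinal.{w}} (hlam : lam.IsRegular)
    {P : ObjectProperty T} (hP : IsConeCoproductClosed lam P)
    (hP' : P ≤ FactorsThroughCoproducts lam P) {H F : T ⥤ A}
    (hH : ∀ I : Type w, PreservesColimitsOfShape (Discrete I) H) {η : P.ι ⋙ H ⟶ P.ι ⋙ F}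
    (hF : (Functor.LeftExtension.mk F η).IsPointwiseLeftKanExtension)
    {I : Type w} {X : I → T} {B : A} {s t : F.obj (∐ X) ⟶ B}
    (h : ∀ i, F.map (Sigma.ι X i) ≫ s = F.map (Sigma.ι X i) ≫ t) : s = t := by
  refine hom_ext_of_isPointwiseLeftKanExtension hF fun C c => ?_
  obtain ⟨J, Z, φ, g, hJ, hZ, h₀, rfl⟩ := hP' _ C.2 I X c
  have hη {C D : T} (hC : P C) (hD : P D) (f : C ⟶ D) :
      H.map f ≫ η.app ⟨D, hD⟩ = η.app ⟨C, hC⟩ ≫ F.map f :=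
    η.naturality (P.homMk f : (⟨C, hC⟩ : P.FullSubcategory) ⟶ ⟨D, hD⟩)
  have hZ' : P (∐ Z) := hP.coproduct_of_support hlam hJ Z hZ h₀
  rw [F.map_comp, Category.assoc, Category.assoc, ← reassoc_of% hη C.2 hZ' g,
    ← reassoc_of% hη C.2 hZ' g]
  congr 1
  refine sigma_hom_ext_of_preserves hH fun i => ?_
  rw [reassoc_of% hη (hZ i) hZ', reassoc_of% hη (hZ i) hZ', ← F.map_comp_assoc,
    ← F.map_comp_assoc, Sigma.ι_map, F.map_comp, Category.assoc, Category.assoc, h]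

variable [HasCoproducts.{w} A]
  {α : Cardinal.{w}} [Fact α.IsRegular] (hA : HasExactCardinalFilteredColimits A α)
  {lam : Cardinal.{w}} [hlam : Fact lam.IsRegular] (hα : α ≤ lam)
  {P : ObjectProperty T} [ObjectProperty.EssentiallySmall.{w} P] [P.IsTriangulated]
  (hP : IsConeCoproductClosed lam P) (hP' : P ≤ FactorsThroughCoproducts lam P)
  (hgen : ∀ R : ObjectProperty T, IsLocalizing R → P ≤ R → ∀ X, R X)
  (H : T ⥤ A) [H.IsHomological]
  (hH : ∀ I : Type w, PreservesColimitsOfShape (Discrete I) H)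

include hA hα hP hP' hgen hH

/-- The comparison `θ` from the Kan extension to `H` is invertible on `P`, and the objects all of
whose shifts have invertible `θ` form a localizing subcategory. -/
lemma eq_zero_of_forall_comp_eq_zero {X : T} {B : A} (t : H.obj X ⟶ B)
    (ht : ∀ ⦃C : T⦄ (c : C ⟶ X), P C → H.map c ≫ t = 0) : t = 0 := by
  have hJ (X : T) := isCardinalFiltered_costructuredArrow hP X
  have hJ' (X : T) := IsCardinalFiltered.of_le (CostructuredArrow P.ι X) hα
  have hfilt (X : T) := isFiltered_of_isCardinalFiltered (CostructuredArrow P.ι X) lam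
  have h₁ (X : T) := hA.of_essentiallySmall (CostructuredArrow P.ι X)
  have h₂ (X : T) (j : CostructuredArrow P.ι X) :=
    have : EssentiallySmall.{w} (Under j) :=
      inferInstanceAs (EssentiallySmall.{w} (StructuredArrow j (𝟭 _)))
    hA.of_essentiallySmall (Under j)
  have h₃ (X : T) := (h₁ X).choose
  have : P.ι.HasPointwiseLeftKanExtension (P.ι ⋙ H) := fun X => by
    infer_instance
  let F := P.ι.pointwiseLeftKanExtension (P.ι ⋙ H)
  let η : P.ι ⋙ H ⟶ P.ι ⋙ F := P.ι.pointwiseLeftKanExtensionUnit (P.ι ⋙ H)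
  have hF : (Functor.LeftExtension.mk F η).IsPointwiseLeftKanExtension :=
    P.ι.pointwiseLeftKanExtensionIsPointwiseLeftKanExtension (P.ι ⋙ H)
  have := hF.isLeftKanExtension
  let θ : F ⟶ H := F.descOfIsLeftKanExtension η H (𝟙 _)
  have hθ (C : P.FullSubcategory) : η.app C ≫ θ.app C.obj = 𝟙 _ :=
    F.descOfIsLeftKanExtension_fac_app η H (𝟙 _) C
  have : F.IsHomological := isHomological_of_isPointwiseLeftKanExtension hF h₁ h₂
  have hloc := isLocalizing_of_five_lemma (fun X : T => IsIso (θ.app X)) ?_ ?_ ?_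
  · have hPθ {C : T} (hC : P C) : IsIso (θ.app C) := by
      have : IsIso (η.app ⟨C, hC⟩) := 
        Functor.LeftExtension.IsPointwiseLeftKanExtensionAt.isIso_hom_app (E := .mk F η)
          (X := ⟨C, hC⟩) (hF C)
      exact IsIso.of_isIso_fac_left (hθ ⟨C, hC⟩)
    have hiso : IsIso (θ.app X) := by
      have h := hgen _ hloc (fun C hC n => hPθ (P.le_shift n _ hC)) X 0
      exact (NatTrans.isIso_app_iff_of_iso θ ((shiftFunctorZero T ℤ).app X)).1 h
    rw [← cancel_epi (θ.app X), comp_zero]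
    refine hom_ext_of_isPointwiseLeftKanExtension hF fun C c => ?_
    rw [θ.naturality_assoc, ht c C.2, comp_zero, comp_zero, comp_zero, comp_zero]
  · intro X Y r hY
    exact ⟨H.map r.i ≫ inv (θ.app Y) ≫ F.map r.r, by
      simp [← Functor.map_comp], by simp [← Functor.map_comp]⟩
  · intro I X hX
    have := hH I
    have := hX
    -- The inverse is built from `H` preserving the coproduct; for `F` it suffices that the
    -- inclusions are jointly epimorphic.
    let s : H.obj (∐ X) ⟶ F.obj (∐ X) :=
      (isColimitOfPreserves H (coproductIsCoproduct X)).desc (Cocone.mk (F.obj (∐ X))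
        (Discrete.natTrans fun i => inv (θ.app (X i.as)) ≫ F.map (Sigma.ι X i.as)))
    have hs (i) : H.map (Sigma.ι X i) ≫ s = inv (θ.app (X i)) ≫ F.map (Sigma.ι X i) :=
      (isColimitOfPreserves H (coproductIsCoproduct X)).fac _ ⟨i⟩
    refine ⟨s, ?_, sigma_hom_ext_of_preserves hH fun i => ?_⟩
    · refine sigma_hom_ext_of_isPointwiseLeftKanExtension hlam.out hP hP' hH hF fun i => ?_
      rw [θ.naturality_assoc, hs, IsIso.hom_inv_id_assoc, Category.comp_id]
    · rw [reassoc_of% hs i, θ.naturality, IsIso.inv_hom_id_assoc, Category.comp_id]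
  · intro X Y Z f g h hT h₁ h₃ h₃' h₁'
    exact isIso_app_of_isHomological θ _ hT h₁ h₃ h₃' h₁'

end

end WellGenerated

/-! ### Factoring maps to the kernel through a small set. -/

namespace WellGenerated

section Factorization

variable {T : Type u} [Category.{w} T] [HasZeroObject T] [HasShift T ℤ] [Preadditive T]
  [∀ n : ℤ, (shiftFunctor T n).Additive] [Pretriangulated T] [HasCoproducts.{w} T]

section

variable {κ : Type w} (G : κ → T)

/-- The cone of the sum of a set of morphisms from the objects `G k` to `X`. -/
noncomputable abbrev coneOfSet {X : T} (N : Set (Σ k, G k ⟶ X)) : T :=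
  coneObj (Sigma.desc fun x : N => x.1.2)

lemma comp_coneMap_of_mem {X : T} {N : Set (Σ k, G k ⟶ X)} {k : κ} {c : G k ⟶ X}
    (hc : ⟨k, c⟩ ∈ N) : c ≫ coneMap (Sigma.desc fun x : N => x.1.2) = 0 := by
  have h := Sigma.ι (fun x : N => G x.1.1) ⟨⟨k, c⟩, hc⟩ ≫=
    comp_coneMap (Sigma.desc fun x : N => x.1.2)
  rwa [Sigma.ι_desc_assoc, comp_zero] at h

/-- The objects obtained from `X` by forming `n` times the cone of a sum of morphisms from
the objects `G k`. -/
noncomputable def iteratedCones (X : T) : ℕ → ObjectProperty T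
  | 0 => .ofObj (fun _ : PUnit.{w + 1} => X)
  | n + 1 => .ofObj fun x : Σ Z : Subtype (iteratedCones X n), Set (Σ k, G k ⟶ Z.1) =>
      coneOfSet G x.2

instance small_iteratedCones (X : T) (n : ℕ) : ObjectProperty.Small.{w} (iteratedCones G X n) := by
  induction n with
  | zero => dsimp only [iteratedCones]; infer_instance
  | succ n ih => dsimp only [iteratedCones]; infer_instance

/-- The homotopy colimits of sequences of iterated cones of `X`. -/
noncomputable def hocolimsOfCones (X : T) : ObjectProperty T :=
  .ofObj fun x : Σ Z : ∀ n, Subtype (iteratedCones G X n), ∀ n, (Z n).1 ⟶ (Z (n + 1)).1 =>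
    coneObj (𝟙 _ - seqShift (fun n => (x.1 n).1) x.2)

instance small_hocolimsOfCones (X : T) : ObjectProperty.Small.{w} (hocolimsOfCones G X) := by
  dsimp only [hocolimsOfCones]; infer_instance

end

variable {A : Type u'} [Category.{w} A] [Abelian A] {H : T ⥤ A} [H.IsHomological]

lemma trW_homologicalKernel_iff {X Y : T} (f : X ⟶ Y) :
    H.homologicalKernel.trW f ↔ ∀ n : ℤ, IsIso (H.map (f⟦n⟧')) :=
  let := Functor.ShiftSequence.tautological H ℤ
  H.mem_homologicalKernel_trW_iff f

/-- `H` and its shifts kill `seqShift X f`, so they send identity minus shift to an identity. -/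
lemma coneObj_homologicalKernel
    (hH : ∀ I : Type w, PreservesColimitsOfShape (Discrete I) H) (X : ℕ → T)
    (f : ∀ n, X n ⟶ X (n + 1)) (hf : ∀ m (n : ℤ), H.map ((f m)⟦n⟧') = 0) :
    H.homologicalKernel (coneObj (𝟙 _ - seqShift X f)) := by
  refine (H.homologicalKernel.trW_iff_of_distinguished _ (cone_distinguished _)).1
    ((trW_homologicalKernel_iff (𝟙 _ - seqShift X f)).2 fun n => ?_)
  have : H.map ((seqShift X f)⟦n⟧') = 0 := by
    refine sigma_hom_ext_of_preserves (H := shiftFunctor T n ⋙ H)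
      (fun I => have := hH I; inferInstance) fun m => ?_
    have h := seqι_shift X f m.down
    change H.map ((seqι X m.down)⟦n⟧') ≫ H.map ((seqShift X f)⟦n⟧') = _ ≫ 0
    rw [← H.map_comp, ← Functor.map_comp, h, Functor.map_comp, H.map_comp, hf, zero_comp,
      comp_zero]
  have h : H.map ((𝟙 (seqSigma X) - seqShift X f)⟦n⟧') = 𝟙 _ := by
    rw [Functor.map_sub, Functor.map_sub, this, sub_zero, CategoryTheory.Functor.map_id,
      CategoryTheory.Functor.map_id]
  have : IsIso (H.map ((𝟙 (seqSigma X) - seqShift X f)⟦n⟧')) := h ▸ inferInstance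
  exact this

variable {κ : Type w} {G : κ → T}
  (hG : ∀ (n : ℤ) ⦃X : T⦄ ⦃B : A⦄ (t : H.obj (X⟦n⟧) ⟶ B),
    (∀ k (c : G k ⟶ X), H.map (c⟦n⟧') ≫ t = 0) → t = 0)

include hG

/-- As `Y` is in the kernel, the fiber of `f` maps onto `H (X⟦n⟧)`; the test objects cover its
value, and every test map through the fiber has been killed in the cone. -/
lemma map_coneMap_eq_zero {X Y : T} (f : X ⟶ Y) (hY : H.homologicalKernel Y) (n : ℤ) :
    H.map ((coneMap (Sigma.desc fun x : { x : Σ k, G k ⟶ X | x.2 ≫ f = 0 } =>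
      x.1.2))⟦n⟧') = 0 := by
  obtain ⟨F, i, δ, hF⟩ := distinguished_cocone_triangle₁ f
  have : Epi (H.map (i⟦n⟧')) := by
    let := Functor.ShiftSequence.tautological H ℤ
    exact (H.homologySequence_epi_shift_map_mor₁_iff _ hF n).2 ((hY n).eq_of_tgt _ _)
  rw [← cancel_epi (H.map (i⟦n⟧')), comp_zero]
  refine hG n _ fun k c => ?_
  have h : i ≫ f = 0 := comp_distTriang_mor_zero₁₂ _ hF
  rw [← H.map_comp, ← H.map_comp, ← Functor.map_comp, ← Functor.map_comp, ← Category.assoc,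
    comp_coneMap_of_mem G (by simp [h]), Functor.map_zero, Functor.map_zero]

/-- Killing at each stage the test maps that vanish in `Y` keeps a map to `Y`, while `H` annihilates
all transitions. The candidates for the homotopy colimit form a small set depending on `X` only. -/
lemma exists_factorization (hH : ∀ I : Type w, PreservesColimitsOfShape (Discrete I) H)
    {X Y : T} (f : X ⟶ Y) (hY : H.homologicalKernel Y) :
    ∃ (Z : T) (a : X ⟶ Z) (b : Z ⟶ Y), hocolimsOfCones G X Z ∧ H.homologicalKernel Z ∧
      a ≫ b = f := by
  have step {X : T} (f : X ⟶ Y) : ∃ g : coneOfSet G { x : Σ k, G k ⟶ X | x.2 ≫ f = 0 } ⟶ Y,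
      coneMap _ ≫ g = f :=
    exists_coneMap_comp _ _ (Sigma.hom_ext _ _ fun x => by
      have := x.2
      rw [Sigma.ι_desc_assoc, comp_zero]
      exact this)
  choose next hnext using fun {X : T} (f : X ⟶ Y) => step f
  let s : ∀ n, Σ Z : Subtype (iteratedCones G X n), Z.1 ⟶ Y := fun n =>
    Nat.rec ⟨⟨X, ObjectProperty.ofObj_apply (fun _ : PUnit.{w + 1} => X) ⟨⟩⟩, f⟩ (fun n z =>
      ⟨⟨coneOfSet G { x : Σ k, G k ⟶ z.1.1 | x.2 ≫ z.2 = 0 }, ObjectProperty.ofObj_apply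
        (fun x : Σ Z : Subtype (iteratedCones G X n), Set (Σ k, G k ⟶ Z.1) => coneOfSet G x.2)
        ⟨z.1, { x : Σ k, G k ⟶ z.1.1 | x.2 ≫ z.2 = 0 }⟩⟩, next z.2⟩) n
  let j (n) : (s n).1.1 ⟶ (s (n + 1)).1.1 :=
    coneMap (Sigma.desc fun x : { x : Σ k, G k ⟶ (s n).1.1 | x.2 ≫ (s n).2 = 0 } => x.1.2)
  have hj (n) : j n ≫ (s (n + 1)).2 = (s n).2 := hnext (s n).2
  let X' (n) : T := (s n).1.1
  obtain ⟨b, hb⟩ := exists_coneMap_comp (𝟙 _ - seqShift X' j) (seqDesc fun n => (s n).2)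
    (seqSigma_hom_ext fun n => by
      rw [Preadditive.sub_comp, Preadditive.comp_sub, Category.id_comp, seqι_desc,
        seqι_shift_assoc, seqι_desc, hj, sub_self, comp_zero])
  refine ⟨_, seqι X' 0 ≫ coneMap _, b, ObjectProperty.ofObj_apply
    (fun x : Σ Z : ∀ n, Subtype (iteratedCones G X n), ∀ n, (Z n).1 ⟶ (Z (n + 1)).1 =>
      coneObj (𝟙 _ - seqShift (fun n => (x.1 n).1) x.2)) ⟨fun n => (s n).1, j⟩,
    coneObj_homologicalKernel hH _ _ fun m n => map_coneMap_eq_zero hG _ hY n, ?_⟩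
  rw [Category.assoc, hb]
  exact seqι_desc _ 0

end Factorization

end WellGenerated

/-! ### Localizations with a right adjoint. -/

namespace WellGenerated

section Reflection

variable {C : Type u} [Category.{w} C] {D : Type*} [Category* D] {Q : C ⥤ D} {R : D ⥤ C}
  (adj : Q ⊣ R) (W : MorphismProperty C) [Q.IsLocalization W]

include W in
-- The transformation `Q.map (unit)` descends along the localization, and the triangle identities
-- make it inverse to the counit.
lemma isIso_counit_of_isLocalization (Y : D) : IsIso (adj.counit.app Y) := by
  let δ : 𝟭 D ⟶ R ⋙ Q := Localization.liftNatTrans Q W Q (Q ⋙ R ⋙ Q) (𝟭 D) (R ⋙ Q)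
    (Functor.whiskerRight adj.unit Q)
  have hδ (X : C) : δ.app (Q.obj X) = Q.map (adj.unit.app X) := by
    simp [δ]
  have h : δ ≫ adj.counit = 𝟙 _ := Localization.natTrans_ext Q W fun X => by
    simp [hδ]
  refine ⟨δ.app Y, ?_, NatTrans.congr_app h Y⟩
  have := δ.naturality (adj.counit.app Y)
  dsimp at this
  rw [this, hδ, ← Q.map_comp, adj.right_triangle_components]
  exact Q.map_id _

include adj W in
lemma isLocalizationFunctor_of_isLocalization : IsLocalizationFunctor (Q ⋙ R) := by
  refine ⟨adj.unit, fun X => ?_⟩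
  have := isIso_counit_of_isLocalization adj W (Q.obj X)
  have hl : Q.map (adj.unit.app X) ≫ adj.counit.app (Q.obj X) = 𝟙 (Q.obj X) :=
    adj.left_triangle_components X
  have h : R.map (Q.map (adj.unit.app X)) = adj.unit.app (R.obj (Q.obj X)) := by
    rw [← cancel_mono (R.map (adj.counit.app (Q.obj X))), adj.right_triangle_components,
      ← R.map_comp]
    exact (congrArg R.map hl).trans (R.map_id _)
  refine ⟨?_, h⟩
  have : IsIso (Q.map (adj.unit.app X) ≫ adj.counit.app (Q.obj X)) := by
    rw [hl]
    exact IsIso.id (Q.obj X)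
  have := IsIso.of_isIso_comp_right (Q.map (adj.unit.app X)) (adj.counit.app (Q.obj X))
  exact inferInstanceAs (IsIso (R.map (Q.map (adj.unit.app X))))

include adj W in
lemma isZero_map_obj_iff_of_isLocalization [HasZeroMorphisms C] [HasZeroMorphisms D]
    [Q.PreservesZeroMorphisms] [R.PreservesZeroMorphisms] (X : C) :
    IsZero (R.obj (Q.obj X)) ↔ IsZero (Q.obj X) := by
  have := isIso_counit_of_isLocalization adj W (Q.obj X)
  exact ⟨fun h => (Q.map_isZero h).of_iso (asIso (adj.counit.app (Q.obj X))).symm,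
    fun h => R.map_isZero h⟩

end Reflection

end WellGenerated

/-! ### The Verdier quotient by the kernel of `H`. -/

namespace WellGenerated

section Quotient

variable {T : Type u} [Category.{w} T] [HasZeroObject T] [HasShift T ℤ] [Preadditive T]
  [∀ n : ℤ, (shiftFunctor T n).Additive] [Pretriangulated T] [IsTriangulated T]
  [HasCoproducts.{w} T] {A : Type u'} [Category.{w} A] [Abelian A] {H : T ⥤ A} [H.IsHomological]
  (hH : ∀ I : Type w, PreservesColimitsOfShape (Discrete I) H)

/-- Both sides amount to the zero endomorphism of `X` belonging to `H.homologicalKernel.trW`. -/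
lemma isZero_Q_obj_iff (X : T) :
    IsZero (H.homologicalKernel.trW.Q.obj X) ↔ ∀ n : ℤ, IsZero (H.obj (X⟦n⟧)) := by
  have h : (∀ n : ℤ, IsZero (H.obj (X⟦n⟧))) ↔ H.homologicalKernel.trW (0 : X ⟶ X) := by
    rw [trW_homologicalKernel_iff]
    refine forall_congr' fun n => ?_
    rw [Functor.map_zero, Functor.map_zero]
    refine ⟨fun h => ⟨0, h.eq_of_src _ _, h.eq_of_src _ _⟩, fun h => ?_⟩
    rw [IsZero.iff_id_eq_zero, ← cancel_epi (0 : H.obj (X⟦n⟧) ⟶ H.obj (X⟦n⟧))]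
    simp
  rw [h]
  refine ⟨fun hX => ?_, fun hX => ?_⟩
  · obtain ⟨X', s, hs, hs'⟩ := (MorphismProperty.map_eq_iff_precomp H.homologicalKernel.trW.Q
      H.homologicalKernel.trW (𝟙 X) 0).1 (hX.eq_of_src _ _)
    rw [comp_zero, Category.comp_id] at hs'
    subst hs'
    rw [← h]
    rw [trW_homologicalKernel_iff] at hs
    intro n
    have := hs n
    rw [Functor.map_zero, Functor.map_zero] at this
    rw [IsZero.iff_id_eq_zero, ← cancel_epi (0 : H.obj (X'⟦n⟧) ⟶ H.obj (X⟦n⟧))]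
    simp
  · have := Localization.inverts H.homologicalKernel.trW.Q H.homologicalKernel.trW _ hX
    rw [Functor.map_zero] at this
    rw [IsZero.iff_id_eq_zero, ← cancel_epi
      (0 : H.homologicalKernel.trW.Q.obj X ⟶ H.homologicalKernel.trW.Q.obj X)]
    simp

lemma isIso_map_sigma_map {F : T ⥤ A}
    (hF : ∀ I : Type w, PreservesColimitsOfShape (Discrete I) F) {I : Type w} {X Y : I → T}
    (f : ∀ i, X i ⟶ Y i) [∀ i, IsIso (F.map (f i))] : IsIso (F.map (Limits.Sigma.map f)) := by
  have := hF I
  let g : F.obj (∐ Y) ⟶ F.obj (∐ X) :=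
    (isColimitOfPreserves F (coproductIsCoproduct Y)).desc (Cocone.mk (F.obj (∐ X))
      (Discrete.natTrans fun i => inv (F.map (f i.as)) ≫ F.map (Sigma.ι X i.as)))
  have hg (i) : F.map (Sigma.ι Y i) ≫ g = inv (F.map (f i)) ≫ F.map (Sigma.ι X i) :=
    (isColimitOfPreserves F (coproductIsCoproduct Y)).fac _ ⟨i⟩
  refine ⟨g, sigma_hom_ext_of_preserves hF fun i => ?_, sigma_hom_ext_of_preserves hF fun i => ?_⟩
  · rw [← F.map_comp_assoc, Sigma.ι_map, F.map_comp, Category.assoc, hg, IsIso.hom_inv_id_assoc,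
      Category.comp_id]
  · rw [reassoc_of% hg, ← F.map_comp, Sigma.ι_map, F.map_comp, IsIso.inv_hom_id_assoc,
      Category.comp_id]

include hH

lemma trW_sigma_map {I : Type w} {X Y : I → T} (f : ∀ i, X i ⟶ Y i)
    (hf : ∀ i, H.homologicalKernel.trW (f i)) :
    H.homologicalKernel.trW (Limits.Sigma.map f) := by
  simp only [trW_homologicalKernel_iff] at hf ⊢
  intro n
  have hf' (i) : IsIso ((shiftFunctor T n ⋙ H).map (f i)) := hf i n
  exact isIso_map_sigma_map (F := shiftFunctor T n ⋙ H)
    (fun I => have := hH I; inferInstance) f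

/-- Calculus of fractions: since the class of inverted morphisms is closed under coproducts,
families of denominators can be replaced by their coproduct. -/
lemma sendsCoproductsToProducts_Q :
    SendsCoproductsToProducts H.homologicalKernel.trW.Q where
  exists_desc {I X Y} y := by
    let W := H.homologicalKernel.trW
    have := Localization.essSurj W.Q W
    obtain ⟨Y, ⟨e⟩⟩ : ∃ Y', Nonempty (W.Q.obj Y' ≅ Y) := ⟨_, ⟨W.Q.objObjPreimageIso Y⟩⟩
    choose φ hφ using fun i => Localization.exists_rightFraction W.Q W (y i ≫ e.inv)
    have hs : W (Limits.Sigma.map fun i => (φ i).s) := trW_sigma_map hH _ fun i => (φ i).hs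
    have := Localization.inverts W.Q W _ hs
    refine ⟨inv (W.Q.map (Limits.Sigma.map fun i => (φ i).s)) ≫
      W.Q.map (Sigma.desc fun i => (φ i).f) ≫ e.hom, fun i => ?_⟩
    have := Localization.inverts W.Q W _ (φ i).hs
    have hι : (φ i).s ≫ Sigma.ι X i = Sigma.ι (fun i => (φ i).X') i ≫
      Limits.Sigma.map fun i => (φ i).s := (Sigma.ι_map (fun i => (φ i).s) i).symm
    rw [← cancel_mono e.inv, ← cancel_epi (W.Q.map (φ i).s), hφ, Category.assoc, Category.assoc,
      Category.assoc, e.hom_inv_id, Category.comp_id, MorphismProperty.RightFraction.map_s_comp_map,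
      ← W.Q.map_comp_assoc, hι, W.Q.map_comp, Category.assoc, IsIso.hom_inv_id_assoc,
      ← W.Q.map_comp, Sigma.ι_desc]
  eq_zero {I X Y} y hy := by
    let W := H.homologicalKernel.trW
    have := Localization.essSurj W.Q W
    obtain ⟨Y, ⟨e⟩⟩ : ∃ Y', Nonempty (W.Q.obj Y' ≅ Y) := ⟨_, ⟨W.Q.objObjPreimageIso Y⟩⟩
    obtain ⟨φ, hφ⟩ := Localization.exists_leftFraction W.Q W (y ≫ e.inv)
    have := Localization.inverts W.Q W _ φ.hs
    have h (i) : W.Q.map (Sigma.ι X i ≫ φ.f) = W.Q.map 0 := by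
      rw [W.Q.map_comp, ← MorphismProperty.LeftFraction.map_comp_map_s φ W.Q
        (Localization.inverts _ _), ← hφ, Category.assoc, reassoc_of% hy i, zero_comp,
        Functor.map_zero]
    choose Z s hs hs' using fun i => (MorphismProperty.map_eq_iff_precomp W.Q W _ _).1 (h i)
    have := Localization.inverts W.Q W _ (trW_sigma_map hH _ hs)
    have hφ₀ : W.Q.map φ.f = 0 := by
      rw [← cancel_epi (W.Q.map (Limits.Sigma.map s)), ← W.Q.map_comp, comp_zero]
      have : Limits.Sigma.map s ≫ φ.f = 0 := Sigma.hom_ext _ _ fun i => by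
        rw [Sigma.ι_map_assoc, hs', comp_zero, comp_zero]
      rw [this, Functor.map_zero]
    rw [← cancel_mono e.inv, hφ, ← cancel_mono (W.Q.map φ.s),
      MorphismProperty.LeftFraction.map_comp_map_s, hφ₀, zero_comp, zero_comp]

variable {κ : Type w} {G : κ → T}
  (hG : ∀ (n : ℤ) ⦃X : T⦄ ⦃B : A⦄ (t : H.obj (X⟦n⟧) ⟶ B),
    (∀ k (c : G k ⟶ X), H.map (c⟦n⟧') ≫ t = 0) → t = 0)

include hG

/-- The denominator `s` of a right fraction has its cone in the kernel; factoring `X ⟶ cone` through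
a member `Z` of a small set, the fiber of `X ⟶ Z` maps to the source of `s` and serves as a new
denominator. -/
lemma small_Q_hom (X : T) (Y : H.homologicalKernel.trW.Localization) :
    Small.{w} (H.homologicalKernel.trW.Q.obj X ⟶ Y) := by
  let W := H.homologicalKernel.trW
  have := Localization.essSurj W.Q W
  obtain ⟨Y, ⟨e⟩⟩ : ∃ Y', Nonempty (W.Q.obj Y' ≅ Y) := ⟨_, ⟨W.Q.objObjPreimageIso Y⟩⟩
  choose F i δ hF using fun {X Z : T} (a : X ⟶ Z) => distinguished_cocone_triangle₁ a
  let E := Σ (Z : Subtype (hocolimsOfCones G X)) (a : X ⟶ Z.1), F a ⟶ Y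
  have hE : Small.{w} E := inferInstance
  classical
  let p : E → (W.Q.obj X ⟶ W.Q.obj Y) := fun x =>
    -- `E` allows any `Z` in the small set, even outside the kernel, so the map to `X` may fail to
    -- be inverted; the value there is irrelevant.
    if h : IsIso (W.Q.map (i x.2.1)) then inv (W.Q.map (i x.2.1)) ≫ W.Q.map x.2.2 else 0
  have hp : Function.Surjective p := fun y => by
    obtain ⟨φ, rfl⟩ := Localization.exists_rightFraction W.Q W y
    have hs := φ.hs
    obtain ⟨V, b, c, hT, hV⟩ := (H.homologicalKernel.trW_iff _).1 hs
    obtain ⟨Z, a, d, hZ, hZ', rfl⟩ := exists_factorization hG hH b hV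
    have h₀ : i a ≫ a = 0 := comp_distTriang_mor_zero₁₂ _ (hF a)
    obtain ⟨r, hr⟩ : ∃ r : F a ⟶ φ.X', i a = r ≫ φ.s :=
      Triangle.coyoneda_exact₂ _ hT _ (by
        change i a ≫ a ≫ d = 0
        rw [reassoc_of% h₀, zero_comp])
    have hi : W (i a) := (H.homologicalKernel.trW_iff_of_distinguished _ (hF a)).2 hZ'
    have hi' := Localization.inverts W.Q W _ hi
    refine ⟨⟨⟨Z, hZ⟩, a, r ≫ φ.f⟩, ?_⟩
    dsimp only [p]
    rw [dif_pos hi', IsIso.inv_comp_eq]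
    rw [W.Q.map_comp, ← MorphismProperty.RightFraction.map_s_comp_map φ W.Q
      (Localization.inverts _ _), ← W.Q.map_comp_assoc, ← hr]
  have := small_of_surjective hp
  exact small_of_injective (f := fun y => y ≫ e.inv) fun _ _ h => (cancel_mono _).1 h

end Quotient

end WellGenerated

/-! ### Test objects from well generation, and the conclusion. -/

namespace WellGenerated

section

variable {T : Type u} [Category.{w} T] [HasZeroObject T] [HasShift T ℤ] [Preadditive T]
  [∀ n : ℤ, (shiftFunctor T n).Additive] [Pretriangulated T] [HasCoproducts.{w} T]

lemma IsWellGenerated.exists_generators (hT : IsWellGenerated T) :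
    ∃ (μ : Cardinal.{w}) (κ : Type w) (G : κ → T), μ.IsRegular ∧ IsPerfect G ∧
      (∀ k, IsCardinalSmall μ (G k)) ∧
      (∀ k (n : ℤ), ∃ k', Nonempty (G k' ≅ (G k)⟦n⟧)) ∧
      ∀ P : ObjectProperty T, IsLocalizing P → (∀ k, P (G k)) → ∀ X, P X := by
  obtain ⟨μ, hμ, S, hS, hSμ⟩ := hT
  have : Small.{w} (Subtype S) := hS.small
  let e := equivShrink.{w} (Subtype S)
  let G (k : Shrink.{w} (Subtype S)) : T := (e.symm k).1
  have hG : IsPerfect G := fun I X Y f hf k =>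
    hS.perfect I X Y f (fun C hC i => by
      obtain ⟨k, hk⟩ := e.symm.surjective ⟨C, hC⟩
      obtain rfl : G k = C := congrArg Subtype.val hk
      exact hf i k) _ (e.symm k).2
  refine ⟨μ, _, _, hμ, hG.shifts, fun k => (hSμ _ (e.symm k.1).2).shift k.2, fun k n =>
    ⟨⟨k.1, k.2 + n⟩, ⟨(shiftFunctorAdd T k.2 n).app _⟩⟩, fun P hP hGP => ?_⟩
  refine hS.generates P hP fun C hC => ?_
  have := hP.retracts
  exact P.prop_of_retract (Retract.ofIso ((shiftFunctorZero T ℤ).app C).symm)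
    (by simpa [G] using hGP ⟨e ⟨C, hC⟩, 0⟩)

variable {A : Type u'} [Category.{w} A] [Abelian A] [HasCoproducts.{w} A]
  {α : Cardinal.{w}} [Fact α.IsRegular] (hA : HasExactCardinalFilteredColimits A α)
  (H : T ⥤ A) [H.IsHomological]
  (hH : ∀ I : Type w, PreservesColimitsOfShape (Discrete I) H)

include hA hH

lemma IsWellGenerated.exists_jointly_epi (hT : IsWellGenerated T) :
    ∃ (κ : Type w) (G : κ → T), ∀ (n : ℤ) ⦃X : T⦄ ⦃B : A⦄ (t : H.obj (X⟦n⟧) ⟶ B),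
      (∀ k (c : G k ⟶ X), H.map (c⟦n⟧') ≫ t = 0) → t = 0 := by
  obtain ⟨μ, κ, G, hμ, hG, hGμ, hshift, hgen⟩ := hT.exists_generators
  obtain ⟨lam, hlam, hαlam, hμlam⟩ : ∃ lam : Cardinal.{w}, lam.IsRegular ∧ α ≤ lam ∧ μ ≤ lam := by
    obtain h | h := le_total α μ
    · exact ⟨μ, hμ, h, le_rfl⟩
    · exact ⟨α, Fact.out, le_rfl, h⟩
  have : Fact lam.IsRegular := ⟨hlam⟩
  let P := coneCoproductClosure lam (ObjectProperty.ofObj G)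
  have hP : IsConeCoproductClosed lam P := isConeCoproductClosed_closure _ _
  have := hP.isClosedUnderIsomorphisms hlam
  have hGP (k) : P (G k) := le_coneCoproductClosure _ _ _ (ObjectProperty.ofObj_apply G k)
  have hs : ∀ X, ObjectProperty.ofObj G X → ∀ n : ℤ, P (X⟦n⟧) := by
    rintro _ ⟨k⟩ n
    obtain ⟨k', ⟨e⟩⟩ := hshift k n
    exact P.prop_of_iso e (hGP k')
  have hs' := coneCoproductClosure_shift hlam hs
  have := isTriangulated_coneCoproductClosure hlam hs
  have := essentiallySmall_coneCoproductClosure (ObjectProperty.ofObj G) hlam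
  have hfac : P ≤ FactorsThroughCoproducts lam P := fun X hX => hX _ (by
    rintro _ ⟨k⟩
    exact factorsThroughCoproducts_of_isPerfect hP hG hGP hμlam hGμ k)
    (isConeCoproductClosed_factorsThroughCoproducts hlam hP hs')
  have h₁ {X : T} {B : A} (t : H.obj X ⟶ B) (ht : ∀ ⦃C : T⦄ (c : C ⟶ X), P C → H.map c ≫ t = 0) :
      t = 0 :=
    eq_zero_of_forall_comp_eq_zero hA hαlam hP hfac (fun R hR hPR =>
      hgen R hR fun k => hPR _ (hGP k)) H hH t ht
  obtain ⟨P₁, _, hP₁⟩ := (inferInstance : ObjectProperty.EssentiallySmall.{w} P)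
  refine ⟨Shrink.{w} (Subtype P₁), fun k => ((equivShrink _).symm k).1, fun n X B t ht => ?_⟩
  refine h₁ t fun C c hC => ?_
  -- A map from `C` to `X⟦n⟧` is the shift of a map from `C⟦-n⟧`, which is again in `P`, so one set
  -- of representatives serves all `n`.
  let ε : (C⟦-n⟧)⟦n⟧ ≅ C := (shiftEquiv T n).counitIso.app C
  obtain ⟨c', hc'⟩ := (shiftFunctor T n).map_surjective (ε.hom ≫ c)
  obtain ⟨Z, hZ, ⟨e⟩⟩ := hP₁ _ (hs' _ hC (-n))
  obtain ⟨k, hk⟩ := (equivShrink (Subtype P₁)).symm.surjective ⟨Z, hZ⟩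
  obtain rfl : ((equivShrink (Subtype P₁)).symm k).1 = Z := congrArg Subtype.val hk
  have h₂ := ht k
  have h₃ : H.map (c'⟦n⟧') ≫ t = 0 := by
    rw [← e.hom_inv_id_assoc c', Functor.map_comp, H.map_comp, Category.assoc, h₂, comp_zero]
  rw [hc', H.map_comp, Category.assoc] at h₃
  rw [← cancel_epi (H.map ε.hom), h₃, comp_zero]

end

end WellGenerated

theorem mainTheorem3 {T : Type u} [Category.{w} T] [HasZeroObject T] [HasShift T ℤ]
    [Preadditive T] [∀ n : ℤ, (shiftFunctor T n).Additive] [Pretriangulated T]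
    [IsTriangulated T] [HasCoproducts.{w} T]
    (hT : WellGenerated.IsWellGenerated T)
    {A : Type u'} [Category.{w} A] [Abelian A] [HasCoproducts.{w} A]
    (α : Cardinal.{w}) [Fact α.IsRegular]
    (hA : WellGenerated.HasExactCardinalFilteredColimits A α)
    (H : T ⥤ A) [H.IsHomological]
    (hH : ∀ I : Type w, PreservesColimitsOfShape (Discrete I) H) :
    ∃ L : T ⥤ T, WellGenerated.IsLocalizationFunctor L ∧ WellGenerated.IsExactFunctor L ∧
      ∀ X : T, IsZero (L.obj X) ↔ ∀ n : ℤ, IsZero (H.obj (X⟦n⟧)) := by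
  obtain ⟨κ, G, hG⟩ := hT.exists_jointly_epi hA H hH
  obtain ⟨_, _, G', -, hG', -, hshift, hgen⟩ := hT.exists_generators
  let W := H.homologicalKernel.trW
  have (X : T) (Y : W.Localization) := WellGenerated.small_Q_hom hH hG X Y
  have : W.Q.IsLeftAdjoint :=
    (WellGenerated.sendsCoproductsToProducts_Q hH).isLeftAdjoint hG' hshift hgen
  let adj : W.Q ⊣ W.Q.rightAdjoint := .ofIsLeftAdjoint W.Q
  -- The right adjoint inherits from `W.Q` the compatibility with the shift and exactness, so the
  -- composite is exact.
  let := adj.rightAdjointCommShift ℤ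
  have := adj.commShift_of_leftAdjoint ℤ
  have := adj.isTriangulated_rightAdjoint
  refine ⟨W.Q ⋙ W.Q.rightAdjoint, WellGenerated.isLocalizationFunctor_of_isLocalization adj W,
    ⟨inferInstance, inferInstance⟩, fun X => ?_⟩
  exact (WellGenerated.isZero_map_obj_iff_of_isLocalization adj W X).trans
    (WellGenerated.isZero_Q_obj_iff X)
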